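/- Let $m\ge 2$. An $m$-ary search tree is grown from the empty tree by inserting real keys $X_1,X_2,\ldots$ one after the other: a node holds up to $m-1$ keys in sorted order; a key reaching an empty (sub)tree creates a leaf holding that key; a key reaching a node with fewer than $m-1$ keys is added to that node; and a key reaching a full node with keys $X_{(1)}\le\cdots\le X_{(m-1)}$ is inserted recursively in the $(i+1)$st of the $m$ ordered subtrees of that node, where $i\in\{0,\ldots,m-1\}$ is such that the key lies in $[X_{(i)},X_{(i+1)})$, with $X_{(0)}=-\infty$ and $X_{(m)}=\infty$. Assume the random permutation model: the $X_i$ are real random variables on a common probability space and, for every $n$, the ranks of $X_1,\ldots,X_n$ form a uniformly random permutation of $\{1,\ldots,n\}$ (as is the case when the $X_i$ are independent with a common continuous distribution). The outdegree of a node is the number of its nonempty subtrees. Let $D_n^{(k)}$ be the number of nodes of outdegree $k$ in the tree after the first $n$ insertions, and let $H_m=\sum_{j=1}^m 1/j$. Then, as $n\to\infty$, almost surely, $$\frac{D_n^{(0)}}{n}\to\frac{m-1}{2(m+1)(H_m-1)},$$ and, for every $k=1,\ldots,m$, almost surely, $$\frac{D_n^{(k)}}{n}\to\frac{1}{m(m+1)(H_m-1)}.$$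 -/

import Mathlib

open MeasureTheory Filter Topology

/-- `m`-ary trees: a tree is either empty (`nil`), or has a root node holding a list of keys and
`m` ordered, possibly empty, subtrees. -/
inductive MTree (m : ℕ) (α : Type) : Type where
  | nil : MTree m α
  | node (keys : List α) (children : Fin m → MTree m α) : MTree m α

namespace MTree

/-- Whether a tree is empty. -/
def isNil {m : ℕ} {α : Type} : MTree m α → Bool
  | nil => true
  | node _ _ => false

/-- Insertion of a key `x` in an `m`-ary search tree. In an empty tree, a new leaf holding only `x`
is created. If the root holds fewer than `m - 1` keys, then `x` is added to the root, in sorted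
position. If the root is filled, with sorted keys `X₍₁₎ ≤ ⋯ ≤ X₍ₘ₋₁₎`, then `x` is inserted in the
subtree of index `i` (counting from `0`), where `x` belongs to `[X₍ᵢ₎, X₍ᵢ₊₁₎)`, with
`X₍₀₎ = -∞` and `X₍ₘ₎ = ∞`; that is, `i` is the number of keys of the root that are at most `x`. -/
def insert {m : ℕ} {α : Type} [LinearOrder α] (x : α) : MTree m α → MTree m α
  | nil => node [x] fun _ => nil
  | node keys c =>
    if keys.length < m - 1 then
      node (keys.orderedInsert (· ≤ ·) x) c
    else
      node keys fun j =>
        if (j : ℕ) = keys.countP (fun y => decide (y ≤ x)) then insert x (c j) else c j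

/-- The `m`-ary search tree grown from the empty tree by inserting successively the keys
`x 0, x 1, …, x (n - 1)`. -/
def grow (m : ℕ) {α : Type} [LinearOrder α] (x : ℕ → α) : ℕ → MTree m α
  | 0 => nil
  | n + 1 => insert (x n) (grow m x n)

/-- The number of nodes of outdegree `k` in a tree, the outdegree of a node being the number of its
children, that is, of its nonempty subtrees. -/
def numOutdegree (k : ℕ) {m : ℕ} {α : Type} : MTree m α → ℕ
  | nil => 0
  | node _ c =>
    (if (Finset.univ.filter fun j => (c j).isNil = false).card = k then 1 else 0) +
      ∑ j, numOutdegree k (c j)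

end MTree

/-- The random permutation model for a sequence of real random keys `X 0, X 1, …`: for every `n`,
the ranks of the first `n` keys form a uniformly random permutation (all the `n!` permutations are
equally likely). The event in `uniform_ranks` says that, for each `i`, the rank of `X i` among the
first `n` keys, counting from `0`, is `σ i`. -/
structure IsRandomPermutationModel {Ω : Type*} [MeasurableSpace Ω] (P : Measure Ω)
    (X : ℕ → Ω → ℝ) : Prop where
  measurable : ∀ i, Measurable (X i)
  uniform_ranks : ∀ (n : ℕ) (σ : Equiv.Perm (Fin n)),
    P {ω | ∀ i j : Fin n, X i ω < X j ω ↔ σ i < σ j} = ((n.factorial : ENNReal))⁻¹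

/-!
Call *stage* of a node its number of keys plus its outdegree. Since only full nodes have children,
the nodes without children are those of stage `1, …, m - 1`, and those of outdegree `k ≥ 1` are
those of stage `m - 1 + k`. A new key hits exactly one node, which passes from its stage `h` to
stage `h + 1`, and it creates in addition a leaf, of stage `1`, if `h ≥ m - 1`
(`MTree.numStage_insert`). After `n` insertions there are `n + 1` gaps for the next key, a node of
stage `s` owns `stageWeight m s` of them (`MTree.sum_hitStage`), and in the random permutation model
the next key chooses its gap uniformly, given the order pattern of the first `n` keys
(`IsRandomPermutationModel.measure_orderPattern_inter_inGap`). So the profile, that is the vector of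
the numbers of nodes of each stage, evolves as a generalized Pólya urn.

The limit `stageDensity m` of the profile divided by `n` is such that the probabilities
`stageWeight m s * stageDensity m s` are stationary for the Markov chain on the stages
`1, …, 2 * m - 2` with jumps `s → s + 1` at rate `stageWeight m (s + 1)` and, for `s ≥ m - 1`,
`s → 1` at rate `stageWeight m 1` (`MTree.sum_stage_stationary`). Let `V n` be the deviation of the
profile from `(n + 1) * stageDensity m`. Its energy `Q (V n)`, the `χ²`-norm attached to the
stationary probabilities, satisfies
`E Q (V (n + 1)) ≤ (1 + 2 (1 - ε) / (n + 1)) * E Q (V n) + C`: the drift is given by the Dirichlet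
form of the chain, which a Poincaré inequality bounds from below (`MTree.exists_energy_step`). Hence
`E Q (V n) = O (n ^ (2 - ε))` (`MTree.exists_integral_energy_le`), which is summable after division
by `n ^ 2` along a sequence of powers `n = j ^ a`. This gives the almost sure convergence along
these powers, and everywhere in between since the profile changes by a bounded amount at every step
(`MTree.ae_tendsto_numStage`).

The stage `2 * m - 1` of the nodes with `m` children has no gaps, so that it is invisible to the
energy; the number of these nodes is recovered from the fact that a tree has one edge less than
nodes (`MTree.sum_mul_numOutdegree`).
-/

/-! ### Stages of nodes and the effect of an insertion -/

namespace MTree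

section Basic

variable {m : ℕ} {α : Type}

/-- The multiset of all keys stored in a tree. -/
def keyMultiset : MTree m α → Multiset α
  | nil => 0
  | node keys c => (keys : Multiset α) + ∑ j, keyMultiset (c j)

/-- The number of nonempty trees in a family of children. -/
def outdegree (c : Fin m → MTree m α) : ℕ :=
  (Finset.univ.filter fun j => (c j).isNil = false).card

/-- The number of nodes of stage `s` in a tree, the stage of a node being its number of keys plus
its outdegree. -/
def numStage (s : ℕ) : MTree m α → ℕ
  | nil => 0
  | node keys c =>
    (if keys.length + outdegree c = s then 1 else 0) + ∑ j, numStage s (c j)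

/-- The stage of the node that absorbs the key `x` when `x` is inserted: either the node that
receives `x`, or the full node that receives a new child holding `x`. The value on the empty tree
is a dummy. -/
def hitStage [LinearOrder α] (x : α) : MTree m α → ℕ
  | nil => 0
  | node keys c =>
    if keys.length < m - 1 then keys.length
    else ∑ j : Fin m, if (j : ℕ) = keys.countP (fun y => decide (y ≤ x)) then
      (if (c j).isNil then keys.length + outdegree c else hitStage x (c j)) else 0

/-- The structural invariants of an `m`-ary search tree: every node holds between `1` and `m - 1`
keys, only full nodes have children, and every key `y` in the subtree of index `j` is routed to that
subtree, that is, exactly `j` keys of the node are at most `y`. -/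
def IsSearch [LinearOrder α] : MTree m α → Prop
  | nil => True
  | node keys c => 1 ≤ keys.length ∧ keys.length ≤ m - 1 ∧
      (∀ j, (c j).isNil = false → keys.length = m - 1) ∧
      (∀ j, ∀ y ∈ keyMultiset (c j), keys.countP (fun z => decide (z ≤ y)) = j) ∧
      ∀ j, IsSearch (c j)

theorem isNil_eq_true_iff {T : MTree m α} : T.isNil = true ↔ T = nil := by
  cases T <;> simp [isNil]

theorem isNil_insert [LinearOrder α] (x : α) (T : MTree m α) : (T.insert x).isNil = false := by
  cases T with
  | nil => simp [insert, isNil]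
  | node keys c => simp only [insert]; split_ifs <;> simp [isNil]

theorem isNil_grow_succ [LinearOrder α] (x : ℕ → α) (n : ℕ) :
    (grow m x (n + 1)).isNil = false := isNil_insert _ _

theorem outdegree_le (c : Fin m → MTree m α) : outdegree c ≤ m := by
  simpa [outdegree] using Finset.card_filter_le Finset.univ fun j => (c j).isNil = false

theorem outdegree_eq_zero {c : Fin m → MTree m α} (h : ∀ j, (c j).isNil = true) :
    outdegree c = 0 := by
  simp [outdegree, h]

theorem card_isNil_add_outdegree (c : Fin m → MTree m α) :
    (Finset.univ.filter fun j => (c j).isNil = true).card + outdegree c = m := by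
  have h := Finset.card_filter_add_card_filter_not (s := (Finset.univ : Finset (Fin m)))
    fun j => (c j).isNil = true
  simpa [outdegree] using h

theorem outdegree_update_of_isNil {c : Fin m → MTree m α} {i : Fin m}
    {t : MTree m α} (hi : (c i).isNil = true) (ht : t.isNil = false) :
    outdegree (Function.update c i t) = outdegree c + 1 := by
  have : (Finset.univ.filter fun j => (Function.update c i t j).isNil = false)
      = Finset.cons i (Finset.univ.filter fun j => (c j).isNil = false) (by simp [hi]) := by
    ext j
    by_cases hj : j = i
    · subst hj; simp [ht]
    · simp [hj]
  rw [outdegree, this, Finset.card_cons, outdegree]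

theorem outdegree_update_of_not_isNil {c : Fin m → MTree m α} {i : Fin m}
    {t : MTree m α} (hi : (c i).isNil = false) (ht : t.isNil = false) :
    outdegree (Function.update c i t) = outdegree c := by
  have : (Finset.univ.filter fun j => (Function.update c i t j).isNil = false)
      = (Finset.univ.filter fun j => (c j).isNil = false) := by
    ext j
    by_cases hj : j = i
    · subst hj; simp [ht, hi]
    · simp [hj]
  rw [outdegree, this, outdegree]

theorem sum_update_add {M : Type*} [AddCommMonoid M] (c : Fin m → MTree m α) (i : Fin m)
    (t : MTree m α) (g : MTree m α → M) :
    (∑ j, g (Function.update c i t j)) + g (c i) = (∑ j, g (c j)) + g t := by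
  rw [← Finset.add_sum_erase _ _ (Finset.mem_univ i),
    ← Finset.add_sum_erase _ (fun j => g (c j)) (Finset.mem_univ i)]
  have : ∑ j ∈ Finset.univ.erase i, g (Function.update c i t j)
      = ∑ j ∈ Finset.univ.erase i, g (c j) :=
    Finset.sum_congr rfl fun j hj => by
      rw [Function.update_of_ne (Finset.ne_of_mem_erase hj)]
  rw [this, Function.update_self]
  abel

/-- The number of edges of a nonempty tree is one less than its number of nodes. -/
theorem sum_mul_numOutdegree (T : MTree m α) :
    ∑ k ∈ Finset.range (m + 1), k * T.numOutdegree k + (if T.isNil then 0 else 1)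
      = ∑ k ∈ Finset.range (m + 1), T.numOutdegree k := by
  induction T with
  | nil => simp [numOutdegree, isNil]
  | node keys c ih =>
    have hnil : (node keys c).isNil = false := rfl
    rw [hnil]
    simp only [numOutdegree, mul_add, Finset.sum_add_distrib, Finset.mul_sum]
    rw [Finset.sum_comm, Finset.sum_comm (s := Finset.range (m + 1))
      (f := fun k j => numOutdegree k (c j))]
    simp only [← ih, Finset.sum_add_distrib]
    have h1 : (∑ j, if (c j).isNil = true then 0 else 1) = outdegree c := by
      rw [outdegree, Finset.card_filter]
      exact Finset.sum_congr rfl fun j _ => by cases (c j).isNil <;> simp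
    rw [h1, ← outdegree]
    have hlt : outdegree c < m + 1 := Nat.lt_succ_of_le (outdegree_le c)
    simp [hlt]
    ring

end Basic

section Order

variable {m : ℕ} {α : Type} [LinearOrder α]

/-- Insertion in a full node replaces the subtree on the route of the key. -/
theorem insert_node_of_full {keys : List α} {c : Fin m → MTree m α} {x : α} {i : Fin m}
    (hfull : ¬ keys.length < m - 1) (hi : (i : ℕ) = keys.countP (fun y => decide (y ≤ x))) :
    insert x (node keys c) = node keys (Function.update c i (insert x (c i))) := by
  simp only [insert, if_neg hfull]
  congr 1
  funext j
  by_cases hj : j = i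
  · subst hj; simp [hi]
  · rw [Function.update_of_ne hj, if_neg]
    rw [← hi]
    exact fun h => hj (Fin.ext h)

theorem hitStage_node_of_full {keys : List α} {c : Fin m → MTree m α} {x : α} {i : Fin m}
    (hfull : ¬ keys.length < m - 1) (hi : (i : ℕ) = keys.countP (fun y => decide (y ≤ x))) :
    hitStage x (node keys c)
      = if (c i).isNil then keys.length + outdegree c else hitStage x (c i) := by
  simp only [hitStage, if_neg hfull]
  rw [Finset.sum_eq_single i]
  · simp [hi]
  · intro j _ hj
    rw [if_neg]
    rw [← hi]
    exact fun h => hj (Fin.ext h)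
  · simp

/-- In a tree satisfying the invariants, every key is routed to an existing subtree. -/
theorem exists_route (hm : 2 ≤ m) {keys : List α} (hlen : keys.length ≤ m - 1) (x : α) :
    ∃ i : Fin m, (i : ℕ) = keys.countP (fun y => decide (y ≤ x)) :=
  ⟨⟨keys.countP (fun y => decide (y ≤ x)), by
    have := List.countP_le_length (p := fun y => decide (y ≤ x)) (l := keys)
    omega⟩, rfl⟩

theorem keyMultiset_insert (hm : 2 ≤ m) (x : α) {T : MTree m α} (hT : T.IsSearch) :
    (T.insert x).keyMultiset = x ::ₘ T.keyMultiset := by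
  induction T with
  | nil => simp [insert, keyMultiset]
  | node keys c ih =>
    obtain ⟨h1, h2, h3, h4, h5⟩ := hT
    by_cases hfull : keys.length < m - 1
    · simp only [insert, if_pos hfull, keyMultiset]
      rw [← Multiset.cons_add, Multiset.cons_coe,
        Multiset.coe_eq_coe.2 (List.perm_orderedInsert (· ≤ ·) x keys)]
    · obtain ⟨i, hi⟩ := exists_route hm h2 x
      rw [insert_node_of_full hfull hi]
      simp only [keyMultiset]
      have := sum_update_add c i (insert x (c i)) keyMultiset
      rw [ih i (h5 i), ← Multiset.singleton_add, ← add_assoc] at this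
      rw [add_right_cancel this, ← Multiset.singleton_add]
      abel

theorem isSearch_insert (hm : 2 ≤ m) (x : α) {T : MTree m α} (hT : T.IsSearch) :
    (T.insert x).IsSearch := by
  induction T with
  | nil =>
    refine ⟨by simp, by simp; omega, ?_, ?_, ?_⟩ <;> simp [isNil, keyMultiset, IsSearch]
  | node keys c ih =>
    obtain ⟨h1, h2, h3, h4, h5⟩ := hT
    by_cases hfull : keys.length < m - 1
    · have hnil : ∀ j, c j = nil := by
        intro j
        rw [← isNil_eq_true_iff, ← Bool.not_eq_false]
        exact fun h => absurd (h3 j h) hfull.ne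
      simp only [insert, if_pos hfull]
      refine ⟨?_, ?_, ?_, ?_, ?_⟩
      · rw [List.orderedInsert_length]; omega
      · rw [List.orderedInsert_length]; omega
      all_goals simp [hnil, isNil, keyMultiset, IsSearch]
    · obtain ⟨i, hi⟩ := exists_route hm h2 x
      rw [insert_node_of_full hfull hi]
      refine ⟨h1, h2, fun _ _ => by omega, fun j y hy => ?_, fun j => ?_⟩
      · by_cases hj : j = i
        · subst hj
          rw [Function.update_self, keyMultiset_insert hm x (h5 j), Multiset.mem_cons] at hy
          rcases hy with rfl | hy
          · exact hi.symm
          · exact h4 j y hy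
        · rw [Function.update_of_ne hj] at hy
          exact h4 j y hy
      · by_cases hj : j = i
        · subst hj; rw [Function.update_self]; exact ih j (h5 j)
        · rw [Function.update_of_ne hj]; exact h5 j

theorem isSearch_grow (hm : 2 ≤ m) (x : ℕ → α) (n : ℕ) : (grow m x n).IsSearch := by
  induction n with
  | zero => trivial
  | succ n ih => exact isSearch_insert hm _ ih

theorem keyMultiset_grow (hm : 2 ≤ m) (x : ℕ → α) (n : ℕ) :
    (grow m x n).keyMultiset = (Multiset.range n).map x := by
  induction n with
  | zero => simp [grow, keyMultiset]
  | succ n ih =>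
    rw [grow, keyMultiset_insert hm _ (isSearch_grow hm x n), ih, Multiset.range_succ,
      Multiset.map_cons]

/-- In a tree satisfying the invariants, a node is of outdegree `k ≥ 1` if and only if it is of
stage `m - 1 + k`. -/
theorem numOutdegree_eq_numStage {k : ℕ} (hk : 1 ≤ k) {T : MTree m α} (hT : T.IsSearch) :
    T.numOutdegree k = T.numStage (m - 1 + k) := by
  induction T with
  | nil => rfl
  | node keys c ih =>
    obtain ⟨h1, h2, h3, h4, h5⟩ := hT
    simp only [numOutdegree, numStage]
    rw [Finset.sum_congr rfl fun j _ => ih j (h5 j)]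
    congr 1
    change (if outdegree c = k then 1 else 0) = _
    refine if_congr ?_ rfl rfl
    by_cases hz : ∀ j, (c j).isNil = true
    · rw [outdegree_eq_zero hz]; omega
    · push Not at hz
      obtain ⟨j, hj⟩ := hz
      have := h3 j (by simpa using hj)
      omega

/-- In a tree satisfying the invariants, the nodes without children are those of stage
`1, …, m - 1`. -/
theorem numOutdegree_zero_eq_sum {T : MTree m α} (hT : T.IsSearch) :
    T.numOutdegree 0 = ∑ s ∈ Finset.Icc 1 (m - 1), T.numStage s := by
  induction T with
  | nil => simp [numOutdegree, numStage]
  | node keys c ih =>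
    obtain ⟨h1, h2, h3, h4, h5⟩ := hT
    simp only [numOutdegree, numStage, Finset.sum_add_distrib]
    rw [Finset.sum_congr rfl fun j _ => ih j (h5 j), Finset.sum_comm, Finset.sum_ite_eq]
    congr 1
    change (if outdegree c = 0 then 1 else 0) = _
    refine if_congr ?_ rfl rfl
    rw [Finset.mem_Icc]
    by_cases hz : ∀ j, (c j).isNil = true
    · rw [outdegree_eq_zero hz]; omega
    · push Not at hz
      obtain ⟨j, hj⟩ := hz
      have := h3 j (by simpa using hj)
      omega

/-- The effect of an insertion on the numbers of nodes of given stages: one node of stage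
`h = hitStage x T` passes to stage `h + 1`, and a leaf (of stage `1`) is born if `h ≥ m - 1`. -/
theorem numStage_insert (hm : 2 ≤ m) (x : α) {T : MTree m α} (hT : T.IsSearch)
    (hne : T.isNil = false) (s : ℕ) :
    (T.insert x).numStage s + (if T.hitStage x = s then 1 else 0)
      = T.numStage s + (if T.hitStage x + 1 = s then 1 else 0)
        + (if m - 1 ≤ T.hitStage x ∧ s = 1 then 1 else 0) := by
  induction T with
  | nil => simp [isNil] at hne
  | node keys c ih =>
    obtain ⟨h1, h2, h3, h4, h5⟩ := hT
    by_cases hfull : keys.length < m - 1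
    · have hnil : ∀ j, (c j).isNil = true := by
        intro j
        rw [← Bool.not_eq_false]
        exact fun h => absurd (h3 j h) hfull.ne
      simp only [insert, hitStage, if_pos hfull, numStage, List.orderedInsert_length,
        outdegree_eq_zero hnil]
      rw [if_neg (c := m - 1 ≤ keys.length ∧ s = 1) (by omega)]
      simp only [add_zero]
      ring
    · obtain ⟨i, hi⟩ := exists_route hm h2 x
      rw [insert_node_of_full hfull hi, hitStage_node_of_full hfull hi]
      have hsum := sum_update_add c i (insert x (c i)) (numStage s)
      simp only [numStage]
      by_cases hnil : (c i).isNil = true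
      · rw [if_pos hnil, outdegree_update_of_isNil hnil (isNil_insert _ _)]
        have hci := isNil_eq_true_iff.1 hnil
        have h6 : numStage s (insert x (c i)) = if s = 1 then 1 else 0 := by
          rw [hci]
          simp [insert, numStage, outdegree, isNil, eq_comm]
        rw [h6, hci, numStage, add_zero] at hsum
        rw [← hci] at hsum
        rw [hsum]
        have h7 : (m - 1 ≤ keys.length + outdegree c ∧ s = 1) ↔ s = 1 := by
          constructor
          · exact fun h => h.2
          · exact fun h => ⟨by omega, h⟩
        simp only [h7, ← add_assoc]
        ring
      · have hnil' : (c i).isNil = false := by simpa using hnil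
        rw [if_neg hnil, outdegree_update_of_not_isNil hnil' (isNil_insert _ _)]
        have := ih i (h5 i) hnil'
        omega

end Order

end MTree

/-! ### Gaps and invariance under relabelling -/

namespace MTree

/-- The number of gaps, that is of possible positions of a new key, at a node of stage `s`: a node
holding `s < m - 1` keys has `s + 1` gaps, and a full node of stage `s = m - 1 + k` has
`m - k = 2 m - 1 - s` empty subtrees. The truncated subtraction gives `0` beyond stage `2 m - 1`,
where there are no nodes. -/
def stageWeight (m s : ℕ) : ℕ := if s < m then s + 1 else 2 * m - 1 - s

section Gaps

variable {m : ℕ} {α : Type} [LinearOrder α]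

/-- A point below `m - 1` distinct keys, together with these keys, provides one representative
`β j` of each of the `m` intervals delimited by the keys. -/
theorem exists_gap_representatives (hm : 2 ≤ m) {keys : List α} (hlen : keys.length = m - 1) {b : α}
    (hb : ∀ y ∈ keys, b < y) (hnd : keys.Nodup) :
    ∃ β : Fin m → α, b ::ₘ (keys : Multiset α) = Finset.univ.val.map β ∧
      (∀ j, keys.countP (fun z => decide (z ≤ β j)) = j) ∧
      ∀ j, β j = b ∨ β j ∈ keys := by
  have hnd' : (b :: keys).Nodup := List.nodup_cons.2 ⟨fun h => (hb b h).false, hnd⟩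
  have hcard : (b :: keys).toFinset.card = m := by
    rw [List.toFinset_card_of_nodup hnd', List.length_cons]; omega
  set β := (b :: keys).toFinset.orderEmbOfFin hcard with hβ
  have hval : b ::ₘ (keys : Multiset α) = Finset.univ.val.map β := by
    have h1 := Finset.map_orderEmbOfFin_univ (b :: keys).toFinset hcard
    have h2 := congrArg Finset.val h1
    rw [Finset.map_val, List.toFinset_val, hnd'.dedup] at h2
    rw [Multiset.cons_coe, ← h2]
    rfl
  have hmem : ∀ j, β j = b ∨ β j ∈ keys := by
    intro j
    have := Finset.orderEmbOfFin_mem (b :: keys).toFinset hcard j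
    exact List.mem_cons.1 (List.mem_toFinset.1 this)
  refine ⟨β, hval, fun j => ?_, hmem⟩
  have h3 : (b ::ₘ (keys : Multiset α)).countP (fun z => z ≤ β j) = (j : ℕ) + 1 := by
    rw [hval, Multiset.countP_map]
    have h4 : ∀ i : Fin m, β i ≤ β j ↔ i ≤ j := fun i => β.le_iff_le
    simp only [h4]
    change (Finset.univ.filter fun i => i ≤ j).card = _
    rw [Finset.filter_ge_eq_Iic, Fin.card_Iic]
  have hbj : b ≤ β j := by
    rcases hmem j with h | h
    · exact h.ge
    · exact (hb _ h).le
  rw [Multiset.countP_cons_of_pos (p := fun z => z ≤ β j) _ hbj, Multiset.coe_countP] at h3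
  exact Nat.succ_injective h3

/-- Counting the gaps of a search tree according to the stage of the node to which they belong.
Every gap is represented by its left endpoint, which is either a key or the point `b` below all
keys. The induction is carried by the fact that the subtree of index `j` of a full node plays,
with the key to the left of its interval as lower point, the same role as the tree with `b`. -/
theorem sum_hitStage (hm : 2 ≤ m) (f : ℕ → ℝ) {T : MTree m α} (hT : T.IsSearch)
    (hne : T.isNil = false) {b : α} (hb : ∀ y ∈ T.keyMultiset, b < y)
    (hnd : T.keyMultiset.Nodup) :
    ((b ::ₘ T.keyMultiset).map fun y => f (T.hitStage y)).sum
      = ∑ s ∈ Finset.range (2 * m), (stageWeight m s : ℝ) * T.numStage s * f s := by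
  induction T generalizing b with
  | nil => simp [isNil] at hne
  | node keys c ih =>
    obtain ⟨h1, h2, h3, h4, h5⟩ := hT
    have hout := outdegree_le c
    have hR : ∑ s ∈ Finset.range (2 * m), (stageWeight m s : ℝ) * (node keys c).numStage s * f s
        = (stageWeight m (keys.length + outdegree c) : ℝ) * f (keys.length + outdegree c)
          + ∑ j, ∑ s ∈ Finset.range (2 * m),
            (stageWeight m s : ℝ) * (c j).numStage s * f s := by
      simp only [numStage, Nat.cast_add, Nat.cast_sum, mul_add, add_mul, Finset.sum_add_distrib,
        Finset.mul_sum, Finset.sum_mul]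
      congr 1
      · rw [Finset.sum_eq_single (keys.length + outdegree c)]
        · simp
        · intro s _ hs; rw [if_neg hs.symm]; simp
        · intro h; rw [Finset.mem_range] at h; omega
      · exact Finset.sum_comm
    rw [hR]
    by_cases hfull : keys.length < m - 1
    · have hnil : ∀ j, (c j).isNil = true := by
        intro j
        rw [← Bool.not_eq_false]
        exact fun h => absurd (h3 j h) hfull.ne
      have hnil' : ∀ j, c j = nil := fun j => isNil_eq_true_iff.1 (hnil j)
      have hw : stageWeight m keys.length = keys.length + 1 := by
        rw [stageWeight, if_pos (by omega)]
      simp [hitStage, if_pos hfull, keyMultiset, hnil', numStage, outdegree, isNil, hw]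
      ring
    · have hlen : keys.length = m - 1 := by omega
      have hkeys : ∀ y ∈ keys, y ∈ (node keys c).keyMultiset := fun y hy => by
        simp only [keyMultiset, Multiset.mem_add, Multiset.mem_coe]; exact Or.inl hy
      have hsub : ∀ j, (c j).keyMultiset ≤ ∑ j, (c j).keyMultiset := fun j =>
        Finset.single_le_sum (f := fun j => (c j).keyMultiset) (fun _ _ => zero_le)
          (Finset.mem_univ j)
      have hchild : ∀ j, ∀ y ∈ (c j).keyMultiset, y ∈ (node keys c).keyMultiset := fun j y hy => by
        simp only [keyMultiset, Multiset.mem_add]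
        exact Or.inr (Multiset.mem_of_le (hsub j) hy)
      have hndk : keys.Nodup := by
        rw [← Multiset.coe_nodup]
        refine Multiset.nodup_of_le ?_ hnd
        simp only [keyMultiset]
        exact le_self_add
      have hdisj : ∀ j, ∀ y ∈ (c j).keyMultiset, y ∉ keys := fun j y hy hy' => by
        simp only [keyMultiset] at hnd
        exact Multiset.disjoint_left.1 (Multiset.nodup_add.1 hnd).2.2 (Multiset.mem_coe.2 hy')
          (Multiset.mem_of_le (hsub j) hy)
      obtain ⟨β, hval, hcount, hmem⟩ := exists_gap_representatives hm hlen
        (fun y hy => hb y (hkeys y hy)) hndk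
      have hβlt : ∀ j, ∀ y ∈ (c j).keyMultiset, β j < y := by
        intro j y hy
        rcases hmem j with h | h
        · rw [h]; exact hb y (hchild j y hy)
        · by_contra hlt
          have hyβ : y < β j := lt_of_le_of_ne (not_lt.1 hlt) fun e => hdisj j y hy (e ▸ h)
          have hc := (h4 j y hy).trans (hcount j).symm
          have hss : keys.countP (fun z => decide (z ≤ y))
              < keys.countP (fun z => decide (z ≤ β j)) := by
            rw [List.countP_eq_length_filter, List.countP_eq_length_filter]
            rw [← List.toFinset_card_of_nodup (hndk.filter _),
              ← List.toFinset_card_of_nodup (hndk.filter _)]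
            refine Finset.card_lt_card ⟨fun z hz => ?_, fun hsub => ?_⟩
            · simp only [List.mem_toFinset, List.mem_filter, decide_eq_true_eq] at hz ⊢
              exact ⟨hz.1, hz.2.trans hyβ.le⟩
            · have hz : β j ∈ (keys.filter fun z => decide (z ≤ β j)).toFinset := by simp [h]
              have := hsub hz
              simp only [List.mem_toFinset, List.mem_filter, decide_eq_true_eq] at this
              exact absurd this.2 (not_le.2 hyβ)
          exact hss.ne hc
      have hroute : ∀ j, ∀ y ∈ β j ::ₘ (c j).keyMultiset,
          (j : ℕ) = keys.countP (fun z => decide (z ≤ y)) := by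
        intro j y hy
        rcases Multiset.mem_cons.1 hy with rfl | hy
        · exact (hcount j).symm
        · exact (h4 j y hy).symm
      have hsplit : b ::ₘ (node keys c).keyMultiset = ∑ j, (β j ::ₘ (c j).keyMultiset) := by
        simp only [keyMultiset, ← Multiset.cons_add, hval]
        simp only [← Multiset.singleton_add, Finset.sum_add_distrib]
        congr 1
        have := Multiset.sum_map_singleton (Finset.univ.val.map β)
        rw [Multiset.map_map] at this
        exact this.symm
      have hmapsum : ∀ (M : Fin m → Multiset α) (g : α → ℝ),
          ((∑ j, M j).map g).sum = ∑ j, ((M j).map g).sum := by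
        intro M g
        have := map_sum (Multiset.sumAddMonoidHom.comp (Multiset.mapAddMonoidHom g)) M Finset.univ
        exact this
      rw [hsplit, hmapsum]
      have hterm : ∀ j, ((β j ::ₘ (c j).keyMultiset).map
            fun y => f ((node keys c).hitStage y)).sum
          = (if (c j).isNil = true then f (keys.length + outdegree c) else 0)
            + ∑ s ∈ Finset.range (2 * m), (stageWeight m s : ℝ) * (c j).numStage s * f s := by
        intro j
        rw [Multiset.map_congr rfl fun y hy => by
          rw [hitStage_node_of_full hfull (hroute j y hy)]]
        by_cases hj : (c j).isNil = true
        · have hcj := isNil_eq_true_iff.1 hj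
          simp only [if_pos hj]
          rw [hcj]
          simp [keyMultiset, numStage]
        · have hj' : (c j).isNil = false := by simpa using hj
          simp only [if_neg hj, zero_add]
          refine ih j (h5 j) hj' (hβlt j) ?_
          simp only [keyMultiset] at hnd
          exact Multiset.nodup_of_le ((hsub j).trans le_add_self) hnd
      rw [Finset.sum_congr rfl fun j _ => hterm j, Finset.sum_add_distrib]
      congr 1
      rw [← Finset.sum_filter, Finset.sum_const, nsmul_eq_mul]
      congr 2
      have := card_isNil_add_outdegree c
      rw [stageWeight]
      split_ifs <;> omega

end Gaps

section Map

variable {m : ℕ} {α β : Type}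

/-- Relabelling of the keys of a tree. -/
def map (f : α → β) : MTree m α → MTree m β
  | nil => nil
  | node keys c => node (keys.map f) fun j => map f (c j)

theorem isNil_map (f : α → β) (T : MTree m α) : (T.map f).isNil = T.isNil := by
  cases T <;> rfl

theorem outdegree_map (f : α → β) (c : Fin m → MTree m α) :
    outdegree (fun j => (c j).map f) = outdegree c := by
  simp [outdegree, isNil_map]

theorem numStage_map (f : α → β) (s : ℕ) (T : MTree m α) :
    (T.map f).numStage s = T.numStage s := by
  induction T with
  | nil => rfl
  | node keys c ih => simp only [map, numStage, outdegree_map, List.length_map, ih]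

variable [LinearOrder α] [LinearOrder β]

theorem map_insert {f : α → β} {x : α} {T : MTree m α}
    (h : ∀ y ∈ T.keyMultiset, (y ≤ x ↔ f y ≤ f x) ∧ (x ≤ y ↔ f x ≤ f y)) :
    (T.insert x).map f = (T.map f).insert (f x) := by
  induction T with
  | nil => simp [insert, map]
  | node keys c ih =>
    have hk : ∀ y ∈ keys, (y ≤ x ↔ f y ≤ f x) ∧ (x ≤ y ↔ f x ≤ f y) := fun y hy =>
      h y (by simp [keyMultiset, hy])
    have hc : ∀ j, ∀ y ∈ (c j).keyMultiset, (y ≤ x ↔ f y ≤ f x) ∧ (x ≤ y ↔ f x ≤ f y) :=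
      fun j y hy => h y (by
        simp only [keyMultiset, Multiset.mem_add, Multiset.mem_sum]
        exact Or.inr ⟨j, Finset.mem_univ _, hy⟩)
    simp only [insert, map, List.length_map, List.countP_map]
    have hcount : keys.countP ((fun y => decide (y ≤ f x)) ∘ f)
        = keys.countP (fun y => decide (y ≤ x)) :=
      List.countP_congr fun y hy => by simpa using (hk y hy).1.symm
    rw [hcount]
    split_ifs
    · simp only [map]
      rw [List.map_orderedInsert _ (· ≤ ·) f keys x (fun y hy => (hk y hy).1)
        (fun y hy => (hk y hy).2)]
    · simp only [map]
      congr 1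
      funext j
      split_ifs
      · exact ih j (hc j)
      · rfl

theorem hitStage_map {f : α → β} {x : α} {T : MTree m α}
    (h : ∀ y ∈ T.keyMultiset, (y ≤ x ↔ f y ≤ f x)) :
    (T.map f).hitStage (f x) = T.hitStage x := by
  induction T with
  | nil => rfl
  | node keys c ih =>
    have hk : ∀ y ∈ keys, (y ≤ x ↔ f y ≤ f x) := fun y hy =>
      h y (by simp [keyMultiset, hy])
    have hc : ∀ j, ∀ y ∈ (c j).keyMultiset, (y ≤ x ↔ f y ≤ f x) :=
      fun j y hy => h y (by
        simp only [keyMultiset, Multiset.mem_add, Multiset.mem_sum]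
        exact Or.inr ⟨j, Finset.mem_univ _, hy⟩)
    simp only [hitStage, map, List.length_map, List.countP_map, isNil_map, outdegree_map]
    have hcount : keys.countP ((fun y => decide (y ≤ f x)) ∘ f)
        = keys.countP (fun y => decide (y ≤ x)) :=
      List.countP_congr fun y hy => by simpa using (hk y hy).symm
    rw [hcount]
    simp only [ih _ (hc _)]

/-- Points that compare in the same way with all the keys of a tree hit the same node. -/
theorem hitStage_congr {x y : α} {T : MTree m α}
    (h : ∀ z ∈ T.keyMultiset, (z ≤ x ↔ z ≤ y)) : T.hitStage x = T.hitStage y := by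
  induction T with
  | nil => rfl
  | node keys c ih =>
    have hk : ∀ z ∈ keys, (z ≤ x ↔ z ≤ y) := fun z hz =>
      h z (by simp [keyMultiset, hz])
    have hc : ∀ j, ∀ z ∈ (c j).keyMultiset, (z ≤ x ↔ z ≤ y) :=
      fun j z hz => h z (by
        simp only [keyMultiset, Multiset.mem_add, Multiset.mem_sum]
        exact Or.inr ⟨j, Finset.mem_univ _, hz⟩)
    have hcount : keys.countP (fun z => decide (z ≤ x))
        = keys.countP (fun z => decide (z ≤ y)) :=
      List.countP_congr fun z hz => by simpa using hk z hz
    simp only [hitStage, hcount, ih _ (hc _)]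

theorem map_grow (hm : 2 ≤ m) {f : α → β} {x : ℕ → α} {y : ℕ → β} {n : ℕ}
    (hf : ∀ i < n, f (x i) = y i) (hxy : ∀ i < n, ∀ j < n, (x i < x j ↔ y i < y j)) :
    (grow m x n).map f = grow m y n := by
  induction n with
  | zero => rfl
  | succ n ih =>
    rw [grow, map_insert, ih (fun i hi => hf i (by omega))
      (fun i hi j hj => hxy i (by omega) j (by omega)), hf n (by omega), grow]
    rw [keyMultiset_grow hm]
    intro z hz
    obtain ⟨i, hi, rfl⟩ := Multiset.mem_map.1 hz
    rw [Multiset.mem_range] at hi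
    rw [hf i (by omega), hf n (by omega), ← not_lt, ← not_lt, ← not_lt, ← not_lt,
      hxy n (by omega) i (by omega), hxy i (by omega) n (by omega)]
    exact ⟨Iff.rfl, Iff.rfl⟩

/-- Sequences with the same order pattern are related by a map that matches their terms. -/
theorem exists_map_of_pattern {x : ℕ → α} {y : ℕ → β} {n : ℕ}
    (hxy : ∀ i < n, ∀ j < n, (x i < x j ↔ y i < y j)) :
    ∃ f : α → β, ∀ i < n, f (x i) = y i := by
  by_cases hn : n = 0
  · exact ⟨fun _ => y 0, fun i hi => by omega⟩
  have hfac : Function.FactorsThrough (fun i : Fin n => y i) (fun i : Fin n => x i) := by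
    intro i j hij
    refine le_antisymm (not_lt.1 fun h => ?_) (not_lt.1 fun h => ?_)
    · exact ((hxy j j.2 i i.2).2 h).ne hij.symm
    · exact ((hxy i i.2 j j.2).2 h).ne hij
  exact ⟨Function.extend (fun i : Fin n => x i) (fun i : Fin n => y i) fun _ => y 0,
    fun i hi => hfac.extend_apply _ ⟨i, hi⟩⟩

/-- The profile of the tree grown from a sequence depends only on the order pattern of the
sequence. -/
theorem numStage_grow_congr (hm : 2 ≤ m) {x : ℕ → α} {y : ℕ → β} {n : ℕ}
    (hxy : ∀ i < n, ∀ j < n, (x i < x j ↔ y i < y j)) (s : ℕ) :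
    (grow m x n).numStage s = (grow m y n).numStage s := by
  obtain ⟨f, hf⟩ := exists_map_of_pattern hxy
  rw [← map_grow hm hf hxy, numStage_map]

theorem hitStage_grow_congr (hm : 2 ≤ m) {x : ℕ → α} {y : ℕ → β} {n : ℕ} {a : α} {b : β}
    (hxy : ∀ i < n, ∀ j < n, (x i < x j ↔ y i < y j)) (hab : ∀ i < n, (x i ≤ a ↔ y i ≤ b))
    (hba : ∀ i < n, (a ≤ x i ↔ b ≤ y i)) :
    (grow m x n).hitStage a = (grow m y n).hitStage b := by
  set x' := Function.update x n a with hx'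
  set y' := Function.update y n b with hy'
  have ex : ∀ i < n, x' i = x i := fun i hi => Function.update_of_ne hi.ne _ _
  have ey : ∀ i < n, y' i = y i := fun i hi => Function.update_of_ne hi.ne _ _
  have exn : x' n = a := Function.update_self _ _ _
  have eyn : y' n = b := Function.update_self _ _ _
  have hxy' : ∀ i < n + 1, ∀ j < n + 1, (x' i < x' j ↔ y' i < y' j) := by
    intro i hi j hj
    rcases Nat.lt_succ_iff_lt_or_eq.1 hi with hi | rfl <;>
    rcases Nat.lt_succ_iff_lt_or_eq.1 hj with hj | rfl
    · rw [ex i hi, ex j hj, ey i hi, ey j hj]; exact hxy i hi j hj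
    · rw [ex i hi, exn, ey i hi, eyn, ← not_le, ← not_le, hba i hi]
    · rw [ex j hj, exn, ey j hj, eyn, ← not_le, ← not_le, hab j hj]
    · simp
  obtain ⟨f, hf⟩ := exists_map_of_pattern hxy'
  have hfa : f a = b := by rw [← exn, hf n (by omega), eyn]
  have hfx : ∀ i < n, f (x i) = y i := fun i hi => by
    rw [← ex i hi, hf i (by omega), ey i hi]
  rw [← map_grow hm hfx hxy, ← hfa, hitStage_map]
  rw [keyMultiset_grow hm]
  intro z hz
  obtain ⟨i, hi, rfl⟩ := Multiset.mem_map.1 hz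
  rw [Multiset.mem_range] at hi
  rw [hfx i hi, hfa, hab i hi]

end Map

end MTree

/-! ### Order patterns and the random permutation model -/

section Pattern

/-- The order pattern of the first `n` terms of a real sequence. -/
noncomputable def orderPattern (n : ℕ) (x : ℕ → ℝ) : Fin n → Fin n → Bool :=
  fun i j => decide (x i < x j)

theorem orderPattern_eq_iff {n : ℕ} {x y : ℕ → ℝ} :
    orderPattern n x = orderPattern n y ↔ ∀ i < n, ∀ j < n, (x i < x j ↔ y i < y j) := by
  constructor
  · intro h i hi j hj
    have := congrFun (congrFun h ⟨i, hi⟩) ⟨j, hj⟩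
    simpa [orderPattern] using this
  · intro h
    funext i j
    simp [orderPattern, h i i.2 j j.2]

/-- A function of real sequences that depends only on the order pattern of the first `n` terms. -/
def PatternInvariant {β : Type*} (n : ℕ) (g : (ℕ → ℝ) → β) : Prop :=
  ∀ x y, orderPattern n x = orderPattern n y → g x = g y

theorem PatternInvariant.exists_eq_comp {n : ℕ} {g : (ℕ → ℝ) → ℝ} (hg : PatternInvariant n g) :
    ∃ H : (Fin n → Fin n → Bool) → ℝ, ∀ x, g x = H (orderPattern n x) :=
  ⟨Function.extend (orderPattern n) g 0, fun x =>
    (Function.FactorsThrough.extend_apply (fun {a b} h => hg a b h) 0 x).symm⟩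

/-- A representative of a gap delimited by the first `n` terms of a sequence: the gap to the right
of the term `x i` is represented by `x i` itself, the leftmost gap by a number smaller than all the
terms. -/
noncomputable def gapPoint (n : ℕ) (x : ℕ → ℝ) : Option (Fin n) → ℝ
  | some i => x i
  | none => -(1 + ∑ i : Fin n, |x i|)

theorem gapPoint_none_lt {n : ℕ} (x : ℕ → ℝ) {j : ℕ} (hj : j < n) :
    gapPoint n x none < x j := by
  have h1 : |x (⟨j, hj⟩ : Fin n)| ≤ ∑ i : Fin n, |x i| :=
    Finset.single_le_sum (f := fun i : Fin n => |x i|) (fun _ _ => abs_nonneg _)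
      (Finset.mem_univ _)
  have h2 := neg_abs_le (x j)
  simp only [gapPoint] at h1 ⊢
  linarith

theorem le_gapPoint_iff {n : ℕ} {x y : ℕ → ℝ} (h : orderPattern n x = orderPattern n y)
    (o : Option (Fin n)) {j : ℕ} (hj : j < n) : x j ≤ gapPoint n x o ↔ y j ≤ gapPoint n y o := by
  cases o with
  | none =>
    exact iff_of_false (not_le.2 (gapPoint_none_lt x hj)) (not_le.2 (gapPoint_none_lt y hj))
  | some i =>
    simp only [gapPoint]
    rw [← not_lt, ← not_lt, orderPattern_eq_iff.1 h i i.2 j hj]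

theorem gapPoint_le_iff {n : ℕ} {x y : ℕ → ℝ} (h : orderPattern n x = orderPattern n y)
    (o : Option (Fin n)) {j : ℕ} (hj : j < n) : gapPoint n x o ≤ x j ↔ gapPoint n y o ≤ y j := by
  cases o with
  | none => exact iff_of_true (gapPoint_none_lt x hj).le (gapPoint_none_lt y hj).le
  | some i =>
    simp only [gapPoint]
    rw [← not_lt, ← not_lt, orderPattern_eq_iff.1 h j hj i i.2]

/-- The term `x n` lies in the gap `o` delimited by the previous terms. -/
def InGap (n : ℕ) (o : Option (Fin n)) (x : ℕ → ℝ) : Prop :=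
  ∀ j : Fin n, (x j ≤ gapPoint n x o ↔ x j < x n)

theorem exists_inGap (n : ℕ) (x : ℕ → ℝ) : ∃ o, InGap n o x := by
  by_cases h : ∃ j : Fin n, x j < x n
  · obtain ⟨j, hj⟩ := h
    obtain ⟨i, hi, hmax⟩ := Finset.exists_max_image
      (Finset.univ.filter fun j : Fin n => x j < x n) (fun j => x j) ⟨j, by simp [hj]⟩
    simp only [Finset.mem_filter, Finset.mem_univ, true_and] at hi hmax
    exact ⟨some i, fun k => ⟨fun hk => lt_of_le_of_lt hk hi, fun hk => hmax k hk⟩⟩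
  · push Not at h
    exact ⟨none, fun k => iff_of_false (not_le.2 (gapPoint_none_lt x k.2)) (not_lt.2 (h k))⟩

theorem inGap_unique {n : ℕ} {x : ℕ → ℝ} (hx : Function.Injective x) {o o' : Option (Fin n)}
    (h : InGap n o x) (h' : InGap n o' x) : o = o' := by
  have key : ∀ (i : Fin n) (o' : Option (Fin n)), InGap n (some i) x → InGap n o' x →
      x i ≤ gapPoint n x o' := fun i o' h h' => (h' i).2 ((h i).1 le_rfl)
  cases o with
  | none =>
    cases o' with
    | none => rfl
    | some i => exact absurd (key i none h' h) (not_le.2 (gapPoint_none_lt x i.2))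
  | some i =>
    cases o' with
    | none => exact absurd (key i none h h') (not_le.2 (gapPoint_none_lt x i.2))
    | some j =>
      have := hx (le_antisymm (key i _ h h') (key j _ h' h))
      rw [Fin.ext this]

/-- Every gap delimited by the first `n` terms contains a number different from these terms. -/
theorem exists_mem_gap (n : ℕ) (x : ℕ → ℝ) (o : Option (Fin n)) :
    ∃ t, ∀ j : Fin n, (x j ≤ gapPoint n x o ↔ x j < t) ∧ x j ≠ t := by
  have : ∀ᶠ t in 𝓝[>] (gapPoint n x o),
      ∀ j : Fin n, (x j ≤ gapPoint n x o ↔ x j < t) ∧ x j ≠ t := by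
    rw [eventually_all]
    intro j
    by_cases hj : x j ≤ gapPoint n x o
    · filter_upwards [self_mem_nhdsWithin] with t ht
      have : x j < t := lt_of_le_of_lt hj ht
      exact ⟨iff_of_true hj this, this.ne⟩
    · filter_upwards [Ioo_mem_nhdsGT (not_le.1 hj)] with t ht
      exact ⟨iff_of_false hj (not_lt.2 ht.2.le), ht.2.ne'⟩
  exact this.exists

end Pattern

namespace IsRandomPermutationModel

variable {Ω : Type*} [MeasurableSpace Ω] {P : Measure Ω}
  {X : ℕ → Ω → ℝ}

theorem measure_orderPattern_eq (hX : IsRandomPermutationModel P X) {n : ℕ} {y : ℕ → ℝ}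
    (hy : Set.InjOn y (Set.Iio n)) :
    P {ω | orderPattern n (fun i => X i ω) = orderPattern n y} = ((n.factorial : ENNReal))⁻¹ := by
  have hinj : Function.Injective fun i : Fin n => y i := fun i j h => Fin.ext (hy i.2 j.2 h)
  have hcard : (Finset.univ.image fun i : Fin n => y i).card = n := by
    rw [Finset.card_image_of_injective _ hinj, Finset.card_univ, Fintype.card_fin]
  set e := (Finset.univ.image fun i : Fin n => y i).orderIsoOfFin hcard
  let σ₀ : Fin n → Fin n := fun i =>
    e.symm ⟨y i, Finset.mem_image_of_mem (fun i : Fin n => y i) (Finset.mem_univ i)⟩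
  have hσ₀ : ∀ i j, σ₀ i < σ₀ j ↔ y i < y j := fun i j => by
    simp only [σ₀, e.symm.lt_iff_lt, Subtype.mk_lt_mk]
  have hbij : Function.Bijective σ₀ := by
    rw [← Finite.injective_iff_bijective]
    intro i j h
    have h' := congrArg Subtype.val (e.symm.injective h)
    exact hinj h'
  rw [← hX.uniform_ranks n (Equiv.ofBijective σ₀ hbij)]
  congr 1
  ext ω
  simp only [Set.mem_ofPred_eq, orderPattern_eq_iff, Equiv.ofBijective_apply, hσ₀]
  exact ⟨fun h i j => h i i.2 j j.2, fun h i hi j hj => h ⟨i, hi⟩ ⟨j, hj⟩⟩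

/-- The events of `uniform_ranks` are disjoint and have total probability one, so that ties
among the keys have probability zero. -/
theorem ae_injOn [IsProbabilityMeasure P] (hX : IsRandomPermutationModel P X) (n : ℕ) :
    ∀ᵐ ω ∂P, Set.InjOn (fun i => X i ω) (Set.Iio n) := by
  set E : Equiv.Perm (Fin n) → Set Ω := fun σ => {ω | ∀ i j : Fin n, X i ω < X j ω ↔ σ i < σ j}
  have hE : ∀ σ, MeasurableSet (E σ) := by
    intro σ
    simp only [E, Set.ofPred_forall]
    refine MeasurableSet.iInter fun i => MeasurableSet.iInter fun j => ?_
    by_cases h : σ i < σ j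
    · simp only [h, iff_true]
      exact measurableSet_lt (hX.measurable _) (hX.measurable _)
    · simp only [h, iff_false, not_lt]
      exact measurableSet_le (hX.measurable _) (hX.measurable _)
  have hdisj : Pairwise (Function.onFun Disjoint E) := by
    intro σ τ hστ
    refine Set.disjoint_left.2 fun ω h1 h2 => hστ ?_
    have h3 : ∀ i j, σ i < σ j ↔ τ i < τ j := fun i j => (h1 i j).symm.trans (h2 i j)
    let f : Fin n ≃o Fin n := ⟨τ.symm.trans σ, fun {a b} => by
      have := h3 (τ.symm b) (τ.symm a)
      simp only [Equiv.apply_symm_apply] at this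
      simp only [Equiv.trans_apply]
      rw [← not_lt, this, not_lt]⟩
    have hf : f = OrderIso.refl _ := Subsingleton.elim _ _
    ext i
    have h4 : f (τ i) = τ i := by rw [hf]; rfl
    have h5 : f (τ i) = σ i := by simp [f]
    rw [← h5, h4]
  have hunion : P (⋃ σ, E σ) = 1 := by
    rw [measure_iUnion hdisj hE, tsum_fintype]
    simp only [E, hX.uniform_ranks]
    rw [Finset.sum_const, Finset.card_univ, Fintype.card_perm, Fintype.card_fin, nsmul_eq_mul]
    exact ENNReal.mul_inv_cancel (by exact_mod_cast n.factorial_ne_zero)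
      (ENNReal.natCast_ne_top _)
  have hae : ∀ᵐ ω ∂P, ω ∈ ⋃ σ, E σ :=
    (prob_compl_eq_zero_iff (MeasurableSet.iUnion hE)).2 hunion
  filter_upwards [hae] with ω hω
  obtain ⟨σ, hσ⟩ := Set.mem_iUnion.1 hω
  intro i hi j hj hij
  have h1 := hσ ⟨i, hi⟩ ⟨j, hj⟩
  have h2 := hσ ⟨j, hj⟩ ⟨i, hi⟩
  simp only at hij h1 h2
  rw [hij] at h1 h2
  simp only [lt_self_iff_false, false_iff, not_lt] at h1 h2
  exact Fin.mk.inj (σ.injective (le_antisymm h2 h1))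

theorem ae_injective [IsProbabilityMeasure P] (hX : IsRandomPermutationModel P X) :
    ∀ᵐ ω ∂P, Function.Injective fun i => X i ω := by
  filter_upwards [ae_all_iff.2 hX.ae_injOn] with ω h i j hij
  exact h (max i j + 1) (Set.mem_Iio.2 (by omega)) (Set.mem_Iio.2 (by omega)) hij

theorem measurable_orderPattern (hX : IsRandomPermutationModel P X) (n : ℕ) :
    Measurable fun ω => orderPattern n (fun i => X i ω) := by
  refine measurable_pi_lambda _ fun i => measurable_pi_lambda _ fun j => ?_
  refine measurable_to_bool ?_
  have : (fun ω => orderPattern n (fun i => X i ω) i j) ⁻¹' {true}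
      = {ω | X i ω < X j ω} := by ext ω; simp [orderPattern]
  rw [this]
  exact measurableSet_lt (hX.measurable _) (hX.measurable _)

theorem measurable_gapPoint (hX : IsRandomPermutationModel P X) {n : ℕ} (o : Option (Fin n)) :
    Measurable fun ω => gapPoint n (fun i => X i ω) o := by
  cases o with
  | none =>
    simp only [gapPoint]
    exact (measurable_const.add (Finset.measurable_sum _ fun i _ => (hX.measurable _).abs)).neg
  | some i => exact hX.measurable _

theorem measurableSet_inGap (hX : IsRandomPermutationModel P X) {n : ℕ} (o : Option (Fin n)) :
    MeasurableSet {ω | InGap n o fun i => X i ω} := by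
  simp only [InGap, Set.ofPred_forall]
  refine MeasurableSet.iInter fun j => ?_
  have h1 : MeasurableSet {ω | X j ω ≤ gapPoint n (fun i => X i ω) o} :=
    measurableSet_le (hX.measurable _) (hX.measurable_gapPoint o)
  have h2 : MeasurableSet {ω | X j ω < X n ω} :=
    measurableSet_lt (hX.measurable _) (hX.measurable _)
  exact measurableSet_setOfPred.2 ((measurableSet_setOfPred.1 h1).iff
    (measurableSet_setOfPred.1 h2))

/-- Given the order pattern of the first `n` keys, the next key falls in each of the `n + 1` gaps
with the same probability. -/
theorem measure_orderPattern_inter_inGap [IsProbabilityMeasure P]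
    (hX : IsRandomPermutationModel P X) (n : ℕ)
    (o : Option (Fin n)) (r : Fin n → Fin n → Bool) :
    P ({ω | orderPattern n (fun i => X i ω) = r} ∩ {ω | InGap n o fun i => X i ω})
      = ((n : ENNReal) + 1)⁻¹ * P {ω | orderPattern n (fun i => X i ω) = r} := by
  by_cases hr : ∃ y : ℕ → ℝ, Set.InjOn y (Set.Iio n) ∧ orderPattern n y = r
  · obtain ⟨y, hy, rfl⟩ := hr
    obtain ⟨t, ht⟩ := exists_mem_gap n y o
    set y' := Function.update y n t with hy'
    have hlt : ∀ j < n, y' j = y j := fun j hj => Function.update_of_ne hj.ne _ _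
    have hn : y' n = t := Function.update_self _ _ _
    have hinj : Set.InjOn y' (Set.Iio (n + 1)) := by
      intro i hi j hj hij
      rw [Set.mem_Iio] at hi hj
      rcases Nat.lt_succ_iff_lt_or_eq.1 hi with hi | rfl <;>
      rcases Nat.lt_succ_iff_lt_or_eq.1 hj with hj | rfl
      · rw [hlt i hi, hlt j hj] at hij; exact hy hi hj hij
      · rw [hlt i hi, hn] at hij; exact absurd hij (ht ⟨i, hi⟩).2
      · rw [hlt j hj, hn] at hij; exact absurd hij.symm (ht ⟨j, hj⟩).2
      · rfl
    have hae : ({ω | orderPattern n (fun i => X i ω) = orderPattern n y} ∩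
          {ω | InGap n o fun i => X i ω} : Set Ω)
        =ᵐ[P] {ω | orderPattern (n + 1) (fun i => X i ω) = orderPattern (n + 1) y'} := by
      filter_upwards [hX.ae_injective] with ω hω
      apply propext
      change (orderPattern n (fun i => X i ω) = orderPattern n y ∧ InGap n o fun i => X i ω) ↔
        orderPattern (n + 1) (fun i => X i ω) = orderPattern (n + 1) y'
      constructor
      · rintro ⟨hp, hg⟩
        have hgap : ∀ j < n, (X j ω < X n ω ↔ y j < t) := fun j hj => by
          rw [← (ht ⟨j, hj⟩).1, ← hg ⟨j, hj⟩, le_gapPoint_iff hp o hj]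
        rw [orderPattern_eq_iff]
        intro i hi j hj
        rcases Nat.lt_succ_iff_lt_or_eq.1 hi with hi | rfl <;>
        rcases Nat.lt_succ_iff_lt_or_eq.1 hj with hj | rfl
        · rw [hlt i hi, hlt j hj]; exact orderPattern_eq_iff.1 hp i hi j hj
        · rw [hlt i hi, hn]; exact hgap i hi
        · rw [hlt j hj, hn]
          have h1 : X j ω ≠ X i ω := fun h => hj.ne (hω h)
          have h2 := (ht ⟨j, hj⟩).2
          rw [← not_le, ← not_le, h1.le_iff_lt, h2.le_iff_lt, hgap j hj]
        · simp
      · intro hp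
        rw [orderPattern_eq_iff] at hp
        have hp' : orderPattern n (fun i => X i ω) = orderPattern n y := by
          rw [orderPattern_eq_iff]
          intro i hi j hj
          rw [← hlt i hi, ← hlt j hj]
          exact hp i (by omega) j (by omega)
        refine ⟨hp', fun j => ?_⟩
        rw [le_gapPoint_iff hp' o j.2, (ht j).1]
        have := hp j (by omega) n (by omega)
        rw [hlt j j.2, hn] at this
        exact this.symm
    rw [measure_congr hae, hX.measure_orderPattern_eq hinj, hX.measure_orderPattern_eq hy,
      Nat.factorial_succ, Nat.cast_mul, Nat.cast_succ, ENNReal.mul_inv]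
    · left; simp
    · right; exact_mod_cast n.factorial_ne_zero
  · have h0 : P {ω | orderPattern n (fun i => X i ω) = r} = 0 := by
      have : ∀ᵐ ω ∂P, ¬ orderPattern n (fun i => X i ω) = r := by
        filter_upwards [hX.ae_injOn n] with ω hω h
        exact hr ⟨_, hω, h⟩
      simpa [ae_iff] using this
    rw [h0, mul_zero]
    exact measure_mono_null Set.inter_subset_left h0

theorem integrable_of_patternInvariant [IsProbabilityMeasure P]
    (hX : IsRandomPermutationModel P X) {n : ℕ}
    {g : (ℕ → ℝ) → ℝ} (hg : PatternInvariant n g) :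
    Integrable (fun ω => g fun i => X i ω) P := by
  obtain ⟨H, hH⟩ := hg.exists_eq_comp
  simp only [hH]
  have : Integrable H (P.map fun ω => orderPattern n (fun i => X i ω)) := by
    have : IsProbabilityMeasure (P.map fun ω => orderPattern n (fun i => X i ω)) :=
      Measure.isProbabilityMeasure_map (hX.measurable_orderPattern n).aemeasurable
    exact Integrable.of_finite
  exact this.comp_measurable (hX.measurable_orderPattern n)

theorem setIntegral_inGap [IsProbabilityMeasure P]
    (hX : IsRandomPermutationModel P X) {n : ℕ} {g : (ℕ → ℝ) → ℝ}
    (hg : PatternInvariant n g) (o : Option (Fin n)) :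
    ∫ ω in {ω | InGap n o fun i => X i ω}, g (fun i => X i ω) ∂P
      = ((n : ℝ) + 1)⁻¹ * ∫ ω, g (fun i => X i ω) ∂P := by
  obtain ⟨H, hH⟩ := hg.exists_eq_comp
  have hR := hX.measurable_orderPattern n
  have hmap : (P.restrict {ω | InGap n o fun i => X i ω}).map
        (fun ω => orderPattern n (fun i => X i ω))
      = ((n : ENNReal) + 1)⁻¹ • P.map (fun ω => orderPattern n (fun i => X i ω)) := by
    refine Measure.ext_of_singleton fun r => ?_
    rw [Measure.map_apply hR (measurableSet_singleton r),
      Measure.restrict_apply (hR (measurableSet_singleton r)), Measure.smul_apply,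
      Measure.map_apply hR (measurableSet_singleton r), smul_eq_mul]
    exact hX.measure_orderPattern_inter_inGap n o r
  simp only [hH]
  have hsm : ∀ μ : Measure (Fin n → Fin n → Bool), AEStronglyMeasurable H μ := fun μ =>
    (Measurable.of_discrete (f := H)).aestronglyMeasurable
  rw [← integral_map hR.aemeasurable (hsm _), ← integral_map hR.aemeasurable (hsm _), hmap,
    integral_smul_measure, smul_eq_mul]
  congr 1
  rw [ENNReal.toReal_inv, ENNReal.toReal_add (ENNReal.natCast_ne_top n) ENNReal.one_ne_top]
  simp

/-- One step of the growth process: a functional that equals `K o` when the new key falls in the gap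
`o`, where `K o` depends only on the previous keys, has mean the average of the means of the `K o`.
-/
theorem integral_eq_average_gaps [IsProbabilityMeasure P]
    (hX : IsRandomPermutationModel P X) {n : ℕ}
    {g : (ℕ → ℝ) → ℝ} (hg : PatternInvariant (n + 1) g) {K : Option (Fin n) → (ℕ → ℝ) → ℝ}
    (hK : ∀ o, PatternInvariant n (K o))
    (h : ∀ x, Function.Injective x → ∀ o, InGap n o x → g x = K o x) :
    ∫ ω, g (fun i => X i ω) ∂P
      = ((n : ℝ) + 1)⁻¹ * ∫ ω, ∑ o, K o (fun i => X i ω) ∂P := by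
  have hgi := hX.integrable_of_patternInvariant hg
  have h1 : (fun ω => g fun i => X i ω) =ᵐ[P] fun ω => ∑ o : Option (Fin n),
      Set.indicator {ω | InGap n o fun i => X i ω} (fun ω => g fun i => X i ω) ω := by
    filter_upwards [hX.ae_injective] with ω hω
    obtain ⟨o, ho⟩ := exists_inGap n fun i => X i ω
    rw [Finset.sum_eq_single o]
    · rw [Set.indicator_of_mem]; exact ho
    · intro o' _ hne
      rw [Set.indicator_of_notMem]
      exact fun h' => hne (inGap_unique hω h' ho)
    · simp
  rw [integral_congr_ae h1, integral_finsetSum _ fun o _ =>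
    hgi.indicator (hX.measurableSet_inGap o), integral_finsetSum _ fun o _ =>
    hX.integrable_of_patternInvariant (hK o), Finset.mul_sum]
  refine Finset.sum_congr rfl fun o _ => ?_
  rw [integral_indicator (hX.measurableSet_inGap o), ← hX.setIntegral_inGap (hK o) o]
  refine setIntegral_congr_ae (hX.measurableSet_inGap o) ?_
  filter_upwards [hX.ae_injective] with ω hω ho
  exact h _ hω o ho

end IsRandomPermutationModel

/-! ### The limit densities and the energy -/

namespace MTree

/-- The limit of the number of nodes of stage `s` divided by the number of keys. -/
noncomputable def stageDensity (m s : ℕ) : ℝ :=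
  (if s < m then 1 / (((s : ℝ) + 1) * (s + 2)) else 1 / ((m : ℝ) * (m + 1))) /
    ((harmonic m : ℝ) - 1)

/-- The indicator that a key hitting a node of stage `s` creates a new leaf. -/
def birth (m s : ℕ) : ℝ := if m - 1 ≤ s then 1 else 0

section Density

variable {m : ℕ}

theorem harmonic_sub_eq_sum (hm : 2 ≤ m) :
    ∑ s ∈ Finset.Icc 1 (m - 2), 1 / ((s : ℝ) + 2) = (harmonic m : ℝ) - 3 / 2 := by
  induction m, hm using Nat.le_induction with
  | base =>
    have : harmonic 2 = 3 / 2 := by norm_num [harmonic, Finset.sum_range_succ]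
    rw [this]; norm_num
  | succ n hn ih =>
    obtain ⟨k, rfl⟩ : ∃ k, n = k + 2 := ⟨n - 2, by omega⟩
    rw [show k + 2 + 1 - 2 = k + 1 by omega, Finset.sum_Icc_succ_top (by omega)]
    rw [show k + 2 - 2 = k by omega] at ih
    rw [ih, harmonic_succ (k + 2)]
    push_cast
    ring

theorem one_lt_harmonic (hm : 2 ≤ m) : (1 : ℝ) < harmonic m := by
  have h1 := harmonic_sub_eq_sum hm
  have h2 : 0 ≤ ∑ s ∈ Finset.Icc 1 (m - 2), 1 / ((s : ℝ) + 2) :=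
    Finset.sum_nonneg fun _ _ => by positivity
  linarith

theorem stageDensity_pos (hm : 2 ≤ m) (s : ℕ) : 0 < stageDensity m s := by
  have h1 := sub_pos.2 (one_lt_harmonic hm)
  have h2 : (0 : ℝ) < m := by exact_mod_cast (by omega : 0 < m)
  unfold stageDensity
  split_ifs <;> positivity

theorem stageWeight_pos {s : ℕ} (hs : s ∈ Finset.Icc 1 (2 * m - 2)) :
    (0 : ℝ) < stageWeight m s := by
  rw [Finset.mem_Icc] at hs
  have : 0 < stageWeight m s := by unfold stageWeight; split_ifs <;> omega
  exact_mod_cast this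

theorem stageWeight_last (hm : 2 ≤ m) : stageWeight m (2 * m - 2 + 1) = 0 := by
  unfold stageWeight; split_ifs <;> omega

theorem stageWeight_one (hm : 2 ≤ m) : stageWeight m 1 = 2 := by
  unfold stageWeight; split_ifs <;> omega

/-- The balance of the probabilities `stageWeight m s * stageDensity m s` at the state `s + 1` of
the chain of `sum_stage_stationary`: this state is entered from `s` only, at rate
`stageWeight m (s + 1)`, and it is left at rate `stageWeight m (s + 1) + 1`. -/
theorem stage_balance (hm : 2 ≤ m) {s : ℕ} (hs : s ∈ Finset.Icc 1 (2 * m - 2)) :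
    (stageWeight m s : ℝ) * stageDensity m s * stageWeight m (s + 1)
      = stageWeight m (s + 1) * stageDensity m (s + 1) * (stageWeight m (s + 1) + 1) := by
  rw [Finset.mem_Icc] at hs
  have h1 := (sub_pos.2 (one_lt_harmonic hm)).ne'
  have h2 : (m : ℝ) ≠ 0 := by exact_mod_cast (by omega : m ≠ 0)
  have h3 : (m : ℝ) + 1 ≠ 0 := by positivity
  by_cases hsm : s + 1 < m
  · have h4 : (s : ℝ) + 1 ≠ 0 := by positivity
    have h5 : (s : ℝ) + 2 ≠ 0 := by positivity
    have h6 : (s : ℝ) + 3 ≠ 0 := by positivity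
    have h7 : (s : ℝ) + 1 + 2 ≠ 0 := by positivity
    have h8 : (s : ℝ) + 1 + 1 ≠ 0 := by positivity
    simp only [stageWeight, stageDensity, if_pos hsm, if_pos (Nat.lt_of_succ_lt hsm)]
    push_cast
    field_simp
    ring
  · have hv : stageDensity m s = stageDensity m (s + 1) := by
      by_cases hs' : s < m
      · have : m = s + 1 := by omega
        subst this
        simp only [stageDensity, lt_irrefl, if_pos hs', if_false]
        push_cast
        ring
      · simp only [stageDensity, if_neg hsm, if_neg hs']
    have hw : stageWeight m s = stageWeight m (s + 1) + 1 := by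
      unfold stageWeight; split_ifs <;> omega
    rw [hv, hw]
    push_cast
    ring

/-- The total rate of the jumps from the state `s` of the chain of `sum_stage_stationary`. -/
theorem stageWeight_succ_add (hm : 2 ≤ m) {s : ℕ} (hs : s ∈ Finset.Icc 1 (2 * m - 2)) :
    (stageWeight m (s + 1) : ℝ) + birth m s * stageWeight m 1 = stageWeight m s + 1 := by
  rw [Finset.mem_Icc] at hs
  rw [stageWeight_one hm]
  by_cases h : m - 1 ≤ s
  · have : stageWeight m (s + 1) + 2 = stageWeight m s + 1 := by
      unfold stageWeight; split_ifs <;> omega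
    rw [birth, if_pos h, one_mul]
    exact_mod_cast this
  · have : stageWeight m (s + 1) = stageWeight m s + 1 := by
      unfold stageWeight; split_ifs <;> omega
    rw [birth, if_neg h, zero_mul, add_zero]
    exact_mod_cast this

theorem sum_Icc_shift (ψ : ℕ → ℝ) (N : ℕ) :
    ∑ h ∈ Finset.Icc 1 N, ψ (h + 1) = ∑ h ∈ Finset.Icc 1 N, ψ h + ψ (N + 1) - ψ 1 := by
  induction N with
  | zero => simp
  | succ N ih =>
    rw [Finset.sum_Icc_succ_top (by omega), Finset.sum_Icc_succ_top (by omega), ih]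
    ring

/-- Stationarity of the probabilities `stageWeight m s * stageDensity m s` for the Markov chain on
the stages that jumps from `s` to `s + 1` at rate `stageWeight m (s + 1)` and, if `s ≥ m - 1`, from
`s` to `1` at rate `stageWeight m 1`. The balance at the state `1` follows from the others. -/
theorem sum_stage_stationary (hm : 2 ≤ m) (g : ℕ → ℝ) :
    ∑ h ∈ Finset.Icc 1 (2 * m - 2), (stageWeight m h : ℝ) * stageDensity m h *
        (stageWeight m (h + 1) * g (h + 1) + birth m h * stageWeight m 1 * g 1)
      = ∑ h ∈ Finset.Icc 1 (2 * m - 2), (stageWeight m h : ℝ) * stageDensity m h *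
        (stageWeight m h + 1) * g h := by
  have hshift : ∀ g : ℕ → ℝ, ∑ h ∈ Finset.Icc 1 (2 * m - 2),
        (stageWeight m h : ℝ) * stageDensity m h * stageWeight m (h + 1) * g (h + 1)
      = ∑ h ∈ Finset.Icc 1 (2 * m - 2), (stageWeight m h : ℝ) * stageDensity m h *
        (stageWeight m h + 1) * g h
        - stageWeight m 1 * stageDensity m 1 * (stageWeight m 1 + 1) * g 1 := by
    intro g
    rw [Finset.sum_congr rfl fun h hh => by rw [stage_balance hm hh],
      sum_Icc_shift (fun h => (stageWeight m h : ℝ) * stageDensity m h *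
        (stageWeight m h + 1) * g h), stageWeight_last hm]
    simp
  have hone : ∑ h ∈ Finset.Icc 1 (2 * m - 2), (stageWeight m h : ℝ) * stageDensity m h *
      (birth m h * stageWeight m 1)
      = stageWeight m 1 * stageDensity m 1 * (stageWeight m 1 + 1) := by
    have h1 := hshift fun _ => 1
    simp only [mul_one] at h1
    have h2 : ∑ h ∈ Finset.Icc 1 (2 * m - 2), (stageWeight m h : ℝ) * stageDensity m h *
          stageWeight m (h + 1)
        + ∑ h ∈ Finset.Icc 1 (2 * m - 2), (stageWeight m h : ℝ) * stageDensity m h *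
          (birth m h * stageWeight m 1)
        = ∑ h ∈ Finset.Icc 1 (2 * m - 2), (stageWeight m h : ℝ) * stageDensity m h *
          (stageWeight m h + 1) := by
      rw [← Finset.sum_add_distrib]
      exact Finset.sum_congr rfl fun h hh => by rw [← stageWeight_succ_add hm hh]; ring
    linarith
  simp only [mul_add, Finset.sum_add_distrib]
  have h2 := hshift g
  simp only [mul_add, add_mul, Finset.sum_add_distrib, mul_one, ← mul_assoc] at h2 hone ⊢
  rw [h2, ← Finset.sum_mul, hone]
  ring

theorem sum_weight_mul_density (hm : 2 ≤ m) :
    ∑ h ∈ Finset.Icc 1 (2 * m - 2), (stageWeight m h : ℝ) * stageDensity m h = 1 := by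
  have h0 := (sub_pos.2 (one_lt_harmonic hm)).ne'
  -- The stages at least `m - 1` are handled by the balance at the state `1`.
  have hfull : ∑ h ∈ Finset.Icc 1 (2 * m - 2), (stageWeight m h : ℝ) * stageDensity m h *
      birth m h = 1 / 2 / ((harmonic m : ℝ) - 1) := by
    have h1 := sum_stage_stationary hm fun h => if h = 1 then 1 else 0
    rw [Finset.sum_congr rfl (g := fun h => (stageWeight m h : ℝ) * stageDensity m h *
      birth m h * 2) fun h hh => by
        rw [Finset.mem_Icc] at hh
        rw [if_neg (by omega), if_pos rfl, stageWeight_one hm]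
        push_cast; ring] at h1
    have h3 : ∑ h ∈ Finset.Icc 1 (2 * m - 2), (stageWeight m h : ℝ) * stageDensity m h *
        (stageWeight m h + 1) * (if h = 1 then 1 else 0)
        = stageWeight m 1 * stageDensity m 1 * (stageWeight m 1 + 1) := by
      rw [Finset.sum_eq_single_of_mem 1 (Finset.mem_Icc.2 ⟨le_rfl, by omega⟩) fun h _ hh => by
        rw [if_neg hh, mul_zero], if_pos rfl, mul_one]
    rw [h3, stageWeight_one hm, stageDensity, if_pos (by omega), ← Finset.sum_mul] at h1
    push_cast at h1
    have h2 : ∑ h ∈ Finset.Icc 1 (2 * m - 2), (stageWeight m h : ℝ) * stageDensity m h *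
      birth m h = (2 * (1 / ((1 + 1) * (1 + 2)) / ((harmonic m : ℝ) - 1)) * (2 + 1)) / 2 := by
      linarith
    rw [h2]
    ring
  have hpart : ∑ h ∈ Finset.Icc 1 (2 * m - 2), (stageWeight m h : ℝ) * stageDensity m h *
      (1 - birth m h) = ((harmonic m : ℝ) - 3 / 2) / ((harmonic m : ℝ) - 1) := by
    rw [← harmonic_sub_eq_sum hm, Finset.sum_div]
    symm
    refine Finset.sum_subset_zero_on_sdiff (Finset.Icc_subset_Icc le_rfl (by omega)) ?_ ?_
    · intro h hh
      rw [Finset.mem_sdiff, Finset.mem_Icc, Finset.mem_Icc] at hh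
      rw [birth, if_pos (by omega)]
      ring
    · intro h hh
      rw [Finset.mem_Icc] at hh
      have h4 : (h : ℝ) + 1 ≠ 0 := by positivity
      have h5 : (h : ℝ) + 2 ≠ 0 := by positivity
      rw [birth, if_neg (by omega), stageWeight, if_pos (by omega), stageDensity,
        if_pos (by omega)]
      push_cast
      field_simp
      ring
  have : ∑ h ∈ Finset.Icc 1 (2 * m - 2), (stageWeight m h : ℝ) * stageDensity m h
      = ∑ h ∈ Finset.Icc 1 (2 * m - 2), (stageWeight m h : ℝ) * stageDensity m h * birth m h
        + ∑ h ∈ Finset.Icc 1 (2 * m - 2), (stageWeight m h : ℝ) * stageDensity m h *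
          (1 - birth m h) := by
    rw [← Finset.sum_add_distrib]
    exact Finset.sum_congr rfl fun h _ => by ring
  rw [this, hfull, hpart]
  field_simp
  ring

end Density

section Energy

variable {m : ℕ}

/-- A Poincaré inequality for the chain on the stages: the variance of a function of the stage is
controlled by its increments along the transitions `s → s + 1`. -/
theorem exists_poincare (hm : 2 ≤ m) : ∃ ε : ℝ, 0 < ε ∧ ε < 1 ∧ ∀ f : ℕ → ℝ,
    ∑ h ∈ Finset.Icc 1 (2 * m - 2), (stageWeight m h : ℝ) * stageDensity m h * f h = 0 →
    2 * ε * ∑ h ∈ Finset.Icc 1 (2 * m - 2), (stageWeight m h : ℝ) * stageDensity m h * f h ^ 2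
      ≤ ∑ h ∈ Finset.Icc 1 (2 * m - 2), (stageWeight m h : ℝ) * stageDensity m h *
        stageWeight m (h + 1) * (f (h + 1) - f h) ^ 2 := by
  obtain ⟨s₀, hs₀, hmin⟩ := Finset.exists_min_image (Finset.Icc 1 (2 * m - 3))
    (fun h => (stageWeight m h : ℝ) * stageDensity m h * stageWeight m (h + 1))
    ⟨1, Finset.mem_Icc.2 ⟨le_rfl, by omega⟩⟩
  set a := (stageWeight m s₀ : ℝ) * stageDensity m s₀ * stageWeight m (s₀ + 1) with ha
  have ha0 : 0 < a := by
    rw [Finset.mem_Icc] at hs₀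
    exact mul_pos (mul_pos (stageWeight_pos (Finset.mem_Icc.2 ⟨by omega, by omega⟩))
      (stageDensity_pos hm _)) (stageWeight_pos (Finset.mem_Icc.2 ⟨by omega, by omega⟩))
  set N : ℝ := ((2 * m - 2 : ℕ) : ℝ) with hN
  have hN0 : 0 < N := by rw [hN]; exact_mod_cast (by omega : 0 < 2 * m - 2)
  refine ⟨min (a / (2 * N)) (1 / 2), by positivity, by
    exact lt_of_le_of_lt (min_le_right _ _) (by norm_num), fun f hf => ?_⟩
  have hπ : ∀ h ∈ Finset.Icc 1 (2 * m - 2), 0 ≤ (stageWeight m h : ℝ) * stageDensity m h :=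
    fun h hh => (mul_pos (stageWeight_pos hh) (stageDensity_pos hm _)).le
  set S := ∑ h ∈ Finset.Icc 1 (2 * m - 3), (f (h + 1) - f h) ^ 2 with hS
  set A := ∑ h ∈ Finset.Icc 1 (2 * m - 2), (stageWeight m h : ℝ) * stageDensity m h * f h ^ 2
    with hA
  have hA0 : 0 ≤ A := Finset.sum_nonneg fun h hh => mul_nonneg (hπ h hh) (sq_nonneg _)
  have hdist : ∀ h ∈ Finset.Icc 1 (2 * m - 2), (f h - f 1) ^ 2 ≤ N * S := by
    intro h hh
    rw [Finset.mem_Icc] at hh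
    rw [← Finset.sum_Ico_sub f hh.1]
    refine sq_sum_le_card_mul_sum_sq.trans ?_
    refine mul_le_mul ?_ ?_ (Finset.sum_nonneg fun _ _ => sq_nonneg _) hN0.le
    · rw [hN, Nat.card_Ico]; exact_mod_cast (by omega : h - 1 ≤ 2 * m - 2)
    · refine Finset.sum_le_sum_of_subset_of_nonneg (fun k hk => ?_) fun _ _ _ => sq_nonneg _
      rw [Finset.mem_Ico] at hk
      exact Finset.mem_Icc.2 ⟨hk.1, by omega⟩
  -- The second moment about the mean `0` is at most the second moment about `f 1`.
  have hvar : A ≤ ∑ h ∈ Finset.Icc 1 (2 * m - 2), (stageWeight m h : ℝ) * stageDensity m h *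
      (f h - f 1) ^ 2 := by
    have : ∑ h ∈ Finset.Icc 1 (2 * m - 2), (stageWeight m h : ℝ) * stageDensity m h *
        (f h - f 1) ^ 2 = A - 2 * f 1 * ∑ h ∈ Finset.Icc 1 (2 * m - 2),
          (stageWeight m h : ℝ) * stageDensity m h * f h
          + f 1 ^ 2 * ∑ h ∈ Finset.Icc 1 (2 * m - 2),
          (stageWeight m h : ℝ) * stageDensity m h := by
      rw [hA, Finset.mul_sum, Finset.mul_sum, ← Finset.sum_sub_distrib, ← Finset.sum_add_distrib]
      exact Finset.sum_congr rfl fun h _ => by ring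
    rw [this, hf, sum_weight_mul_density hm]
    nlinarith [sq_nonneg (f 1)]
  have hANS : A ≤ N * S := by
    refine hvar.trans ?_
    calc _ ≤ ∑ h ∈ Finset.Icc 1 (2 * m - 2),
          (stageWeight m h : ℝ) * stageDensity m h * (N * S) :=
          Finset.sum_le_sum fun h hh => mul_le_mul_of_nonneg_left (hdist h hh) (hπ h hh)
      _ = N * S := by rw [← Finset.sum_mul, sum_weight_mul_density hm, one_mul]
  have hSD : a * S ≤ ∑ h ∈ Finset.Icc 1 (2 * m - 2), (stageWeight m h : ℝ) * stageDensity m h *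
        stageWeight m (h + 1) * (f (h + 1) - f h) ^ 2 := by
    rw [hS, Finset.mul_sum]
    calc _ ≤ ∑ h ∈ Finset.Icc 1 (2 * m - 3), (stageWeight m h : ℝ) * stageDensity m h *
        stageWeight m (h + 1) * (f (h + 1) - f h) ^ 2 :=
          Finset.sum_le_sum fun h hh => mul_le_mul_of_nonneg_right (hmin h hh) (sq_nonneg _)
      _ ≤ _ := Finset.sum_le_sum_of_subset_of_nonneg (Finset.Icc_subset_Icc le_rfl (by omega))
          fun h hh _ => mul_nonneg (mul_nonneg (hπ h hh) (Nat.cast_nonneg _)) (sq_nonneg _)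
  calc 2 * min (a / (2 * N)) (1 / 2) * A ≤ 2 * (a / (2 * N)) * (N * S) := by
        gcongr
        exact min_le_left _ _
    _ = a * S := by field_simp
    _ ≤ _ := hSD

/-- The drift of the energy: the Dirichlet form of the chain on the stages is computed by
stationarity and bounded from below by the Poincaré inequality. -/
theorem exists_drift_bound (hm : 2 ≤ m) : ∃ ε : ℝ, 0 < ε ∧ ε < 1 ∧ ∀ (f : ℕ → ℝ) (M : ℝ),
    ∑ h ∈ Finset.Icc 1 (2 * m - 2), (stageWeight m h : ℝ) * stageDensity m h * f h = 0 →
    ∑ h ∈ Finset.Icc 1 (2 * m - 2), (stageWeight m h : ℝ) * (stageDensity m h * (f h + M)) *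
        (stageWeight m (h + 1) * f (h + 1) - stageWeight m h * f h
          + birth m h * (stageWeight m 1 * f 1))
      ≤ (1 - ε) * ∑ h ∈ Finset.Icc 1 (2 * m - 2),
          (stageWeight m h : ℝ) * stageDensity m h * f h ^ 2 := by
  obtain ⟨ε, hε, hε1, hpoinc⟩ := exists_poincare hm
  refine ⟨ε, hε, hε1, fun f M hf => ?_⟩
  have hp := hpoinc f hf
  have h1 := sum_stage_stationary hm f
  have h2 := sum_stage_stationary hm fun h => f h ^ 2
  have h3 : 0 ≤ ∑ h ∈ Finset.Icc 1 (2 * m - 2), (stageWeight m h : ℝ) * stageDensity m h *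
      (birth m h * stageWeight m 1) * (f h - f 1) ^ 2 := by
    refine Finset.sum_nonneg fun h hh => mul_nonneg (mul_nonneg (mul_pos (stageWeight_pos hh)
      (stageDensity_pos hm _)).le (mul_nonneg ?_ (Nat.cast_nonneg _))) (sq_nonneg _)
    unfold birth; split_ifs <;> norm_num
  -- Polarization: `f h * f t = (f h ^ 2 + f t ^ 2 - (f h - f t) ^ 2) / 2` for each transition.
  have key : ∑ h ∈ Finset.Icc 1 (2 * m - 2), (stageWeight m h : ℝ) * (stageDensity m h *
        (f h + M)) * (stageWeight m (h + 1) * f (h + 1) - stageWeight m h * f h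
          + birth m h * (stageWeight m 1 * f 1))
      = ∑ h ∈ Finset.Icc 1 (2 * m - 2), (stageWeight m h : ℝ) * stageDensity m h * f h ^ 2
        + M * ∑ h ∈ Finset.Icc 1 (2 * m - 2), (stageWeight m h : ℝ) * stageDensity m h * f h
        + M * (∑ h ∈ Finset.Icc 1 (2 * m - 2), (stageWeight m h : ℝ) * stageDensity m h *
        (stageWeight m (h + 1) * f (h + 1) + birth m h * stageWeight m 1 * f 1)
          - ∑ h ∈ Finset.Icc 1 (2 * m - 2), (stageWeight m h : ℝ) * stageDensity m h *
        (stageWeight m h + 1) * f h)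
        + 1 / 2 * (∑ h ∈ Finset.Icc 1 (2 * m - 2), (stageWeight m h : ℝ) * stageDensity m h *
        (stageWeight m (h + 1) * f (h + 1) ^ 2 + birth m h * stageWeight m 1 * f 1 ^ 2)
          - ∑ h ∈ Finset.Icc 1 (2 * m - 2), (stageWeight m h : ℝ) * stageDensity m h *
        (stageWeight m h + 1) * f h ^ 2)
        - 1 / 2 * ∑ h ∈ Finset.Icc 1 (2 * m - 2), (stageWeight m h : ℝ) * stageDensity m h *
        stageWeight m (h + 1) * (f (h + 1) - f h) ^ 2
        - 1 / 2 * ∑ h ∈ Finset.Icc 1 (2 * m - 2), (stageWeight m h : ℝ) * stageDensity m h *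
      (birth m h * stageWeight m 1) * (f h - f 1) ^ 2 := by
    simp only [Finset.mul_sum, ← Finset.sum_sub_distrib, ← Finset.sum_add_distrib]
    refine Finset.sum_congr rfl fun h hh => ?_
    linear_combination (1 / 2 * (stageWeight m h : ℝ) * stageDensity m h * f h ^ 2) *
      stageWeight_succ_add hm hh
  rw [key, hf, h1, h2]
  linarith

/-- The energy of a deviation `V` of the profile from its limit: the `χ²`-norm of the masses
`stageWeight m s * V s` with respect to the probabilities `stageWeight m s * stageDensity m s`. Only
stages with gaps contribute. -/
noncomputable def energy (m : ℕ) (V : ℕ → ℝ) : ℝ :=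
  ∑ s ∈ Finset.Icc 1 (2 * m - 2), (stageWeight m s : ℝ) * V s ^ 2 / stageDensity m s

/-- The change of the profile caused by a key that hits a node of stage `h`. -/
def hitChange (m h s : ℕ) : ℝ :=
  (if h + 1 = s then 1 else 0) - (if h = s then 1 else 0) + (if s = 1 then birth m h else 0)

theorem energy_nonneg (hm : 2 ≤ m) (V : ℕ → ℝ) : 0 ≤ energy m V :=
  Finset.sum_nonneg fun s _ => div_nonneg (mul_nonneg (Nat.cast_nonneg _) (sq_nonneg _))
    (stageDensity_pos hm s).le

theorem sq_le_mul_energy (hm : 2 ≤ m) (V : ℕ → ℝ) {s : ℕ} (hs : s ∈ Finset.Icc 1 (2 * m - 2)) :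
    V s ^ 2 ≤ stageDensity m s / stageWeight m s * energy m V := by
  have h1 : (stageWeight m s : ℝ) * V s ^ 2 / stageDensity m s ≤ energy m V :=
    Finset.single_le_sum
      (f := fun s => (stageWeight m s : ℝ) * V s ^ 2 / stageDensity m s)
      (fun s _ => div_nonneg (mul_nonneg (Nat.cast_nonneg _) (sq_nonneg _))
        (stageDensity_pos hm s).le) hs
  have hw := stageWeight_pos hs
  have hv := stageDensity_pos hm s
  calc V s ^ 2 = stageDensity m s / stageWeight m s *
        ((stageWeight m s : ℝ) * V s ^ 2 / stageDensity m s) := by field_simp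
    _ ≤ _ := by gcongr

theorem sum_mul_hitChange (hm : 2 ≤ m) (g : ℕ → ℝ) (hg : g (2 * m - 2 + 1) = 0) {h : ℕ}
    (hh : h ∈ Finset.Icc 1 (2 * m - 2)) :
    ∑ s ∈ Finset.Icc 1 (2 * m - 2), g s * hitChange m h s
      = g (h + 1) - g h + birth m h * g 1 := by
  have h1 : (1 : ℕ) ∈ Finset.Icc 1 (2 * m - 2) := Finset.mem_Icc.2 ⟨le_rfl, by omega⟩
  simp only [hitChange, mul_add, mul_sub, Finset.sum_add_distrib, Finset.sum_sub_distrib,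
    mul_ite, mul_one, mul_zero, Finset.sum_ite_eq, Finset.sum_ite_eq', if_pos hh, if_pos h1]
  rw [mul_comm (g 1)]
  congr 2
  split_ifs with h2
  · rfl
  · have : h = 2 * m - 2 := by rw [Finset.mem_Icc] at hh h2; omega
    rw [this, hg]

/-- The mean energy after one more insertion, given the present deviation `V` of the profile
`V + M * stageDensity m`, where `M` is the number of gaps. -/
theorem exists_energy_step (hm : 2 ≤ m) : ∃ ε C : ℝ, 0 < ε ∧ ε < 1 ∧ 0 ≤ C ∧
    ∀ (V : ℕ → ℝ) (M : ℝ), (∀ s, 0 ≤ V s + M * stageDensity m s) →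
    ∑ s ∈ Finset.Icc 1 (2 * m - 2), (stageWeight m s : ℝ) * V s = 0 →
    ∑ h ∈ Finset.Icc 1 (2 * m - 2), (stageWeight m h : ℝ) * (V h + M * stageDensity m h) *
        energy m (fun s => V s + (hitChange m h s - stageDensity m s))
      ≤ (M + 2 * (1 - ε)) * energy m V + C * M := by
  obtain ⟨ε, hε, hε1, hdrift⟩ := exists_drift_bound hm
  set e : ℕ → ℝ := fun h => energy m fun s => hitChange m h s - stageDensity m s with he
  have he0 : ∀ h, 0 ≤ e h := fun h => energy_nonneg hm _
  refine ⟨ε, ∑ h ∈ Finset.Icc 1 (2 * m - 2), e h, hε, hε1,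
    Finset.sum_nonneg fun h _ => he0 h, fun V M hZ hV => ?_⟩
  set f : ℕ → ℝ := fun s => V s / stageDensity m s with hf
  have hVf : ∀ s, V s = stageDensity m s * f s := fun s => by
    have := (stageDensity_pos hm s).ne'
    simp only [hf]; field_simp
  have hQ : energy m V = ∑ h ∈ Finset.Icc 1 (2 * m - 2),
      (stageWeight m h : ℝ) * stageDensity m h * f h ^ 2 := by
    refine Finset.sum_congr rfl fun s _ => ?_
    have := (stageDensity_pos hm s).ne'
    rw [hVf s]; field_simp
  have hf0 : ∑ h ∈ Finset.Icc 1 (2 * m - 2),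
      (stageWeight m h : ℝ) * stageDensity m h * f h = 0 := by
    rw [← hV]
    exact Finset.sum_congr rfl fun s _ => by rw [hVf s]; ring
  have hM : ∑ h ∈ Finset.Icc 1 (2 * m - 2),
      (stageWeight m h : ℝ) * (V h + M * stageDensity m h) = M := by
    have : ∀ h, (stageWeight m h : ℝ) * (V h + M * stageDensity m h)
        = stageWeight m h * V h + M * (stageWeight m h * stageDensity m h) := fun h => by ring
    simp only [this, Finset.sum_add_distrib, hV, ← Finset.mul_sum, sum_weight_mul_density hm]
    ring
  have hexp : ∀ h ∈ Finset.Icc 1 (2 * m - 2),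
      energy m (fun s => V s + (hitChange m h s - stageDensity m s))
      = energy m V + 2 * (stageWeight m (h + 1) * f (h + 1) - stageWeight m h * f h
          + birth m h * (stageWeight m 1 * f 1)) + e h := by
    intro h hh
    have h1 := sum_mul_hitChange hm (fun s => (stageWeight m s : ℝ) * f s)
      (by rw [stageWeight_last hm]; simp) hh
    rw [← h1, ← sub_zero (∑ s ∈ Finset.Icc 1 (2 * m - 2), _), ← hV, ← Finset.sum_sub_distrib,
      Finset.mul_sum, he]
    simp only [energy]
    rw [← Finset.sum_add_distrib, ← Finset.sum_add_distrib]
    refine Finset.sum_congr rfl fun s _ => ?_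
    have := (stageDensity_pos hm s).ne'
    rw [hVf s]
    field_simp
    ring
  have hd := hdrift f M hf0
  calc _ = ∑ h ∈ Finset.Icc 1 (2 * m - 2), ((stageWeight m h : ℝ) *
          (V h + M * stageDensity m h) * energy m V
          + 2 * ((stageWeight m h : ℝ) * (stageDensity m h * (f h + M)) *
            (stageWeight m (h + 1) * f (h + 1) - stageWeight m h * f h
            + birth m h * (stageWeight m 1 * f 1)))
          + (stageWeight m h : ℝ) * (V h + M * stageDensity m h) * e h) := by
        refine Finset.sum_congr rfl fun h hh => ?_
        rw [hexp h hh, hVf h]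
        ring
    _ = M * energy m V + 2 * ∑ h ∈ Finset.Icc 1 (2 * m - 2), (stageWeight m h : ℝ) *
          (stageDensity m h * (f h + M)) *
            (stageWeight m (h + 1) * f (h + 1) - stageWeight m h * f h
            + birth m h * (stageWeight m 1 * f 1))
          + ∑ h ∈ Finset.Icc 1 (2 * m - 2),
            (stageWeight m h : ℝ) * (V h + M * stageDensity m h) * e h := by
        rw [Finset.sum_add_distrib, Finset.sum_add_distrib, ← Finset.sum_mul, hM, Finset.mul_sum]
    _ ≤ M * energy m V + 2 * ((1 - ε) * energy m V)
          + ∑ h ∈ Finset.Icc 1 (2 * m - 2), (stageWeight m h : ℝ) *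
            (V h + M * stageDensity m h) * ∑ h ∈ Finset.Icc 1 (2 * m - 2), e h := by
        rw [← hQ] at hd
        refine add_le_add (by linarith) (Finset.sum_le_sum fun h hh => ?_)
        exact mul_le_mul_of_nonneg_left (Finset.single_le_sum (fun h _ => he0 h) hh)
          (mul_nonneg (Nat.cast_nonneg _) (hZ h))
    _ = _ := by rw [← Finset.sum_mul, hM]; ring

end Energy

end MTree

/-! ### Growth rates and almost sure convergence -/

section Analysis

/-- Sequences growing at rate `2 (1 - ε) / n`, with bounded source term, are `O(n ^ (2 - ε))`. -/
theorem exists_le_rpow_of_recursion {ε C : ℝ} (hε : 0 < ε) (hε1 : ε < 1) (hC : 0 ≤ C) {e : ℕ → ℝ}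
    (h : ∀ n, 1 ≤ n → e (n + 1) ≤ (1 + 2 * (1 - ε) / (n + 1)) * e n + C) :
    ∃ K : ℝ, 0 ≤ K ∧ ∀ n : ℕ, 1 ≤ n → e n ≤ K * (n : ℝ) ^ (2 - ε) := by
  set K := max (e 1) (C / ε) with hK
  have hCK : C ≤ K * ε := by
    rw [← div_le_iff₀ hε]; exact le_max_right _ _
  have hK0 : 0 ≤ K := (div_nonneg hC hε.le).trans (le_max_right _ _)
  refine ⟨K, hK0, fun n hn => ?_⟩
  induction n, hn using Nat.le_induction with
  | base => rw [Nat.cast_one, Real.one_rpow, mul_one]; exact le_max_left _ _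
  | succ n hn ih =>
    have hn0 : (0 : ℝ) < n := by exact_mod_cast hn
    have hn1 : (1 : ℝ) ≤ n := by exact_mod_cast hn
    set A := (n : ℝ) ^ (2 - ε) with hA
    have hAn : (n : ℝ) ≤ A := by
      calc (n : ℝ) = (n : ℝ) ^ (1 : ℝ) := (Real.rpow_one _).symm
        _ ≤ A := Real.rpow_le_rpow_of_exponent_le hn1 (by linarith)
    have hbern : A * (1 + (2 - ε) / n) ≤ ((n : ℝ) + 1) ^ (2 - ε) := by
      have h1 : (n : ℝ) + 1 = n * (1 + 1 / n) := by field_simp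
      rw [h1, Real.mul_rpow hn0.le (by positivity)]
      refine mul_le_mul_of_nonneg_left ?_ (by positivity)
      have := one_add_mul_self_le_rpow_one_add (s := 1 / (n : ℝ)) (p := 2 - ε)
        (by have : (0 : ℝ) ≤ 1 / n := by positivity
            linarith) (by linarith)
      calc 1 + (2 - ε) / n = 1 + (2 - ε) * (1 / (n : ℝ)) := by ring
        _ ≤ _ := this
    have hrate : 2 * (1 - ε) / ((n : ℝ) + 1) ≤ 2 * (1 - ε) / n :=
      div_le_div_of_nonneg_left (by linarith) hn0 (by linarith)
    have hsrc : C ≤ K * (ε * (A / n)) := by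
      have : 1 ≤ A / n := (one_le_div hn0).2 hAn
      calc C ≤ K * ε := hCK
        _ = K * (ε * 1) := by ring
        _ ≤ _ := by gcongr
    push_cast
    calc e (n + 1) ≤ (1 + 2 * (1 - ε) / ((n : ℝ) + 1)) * e n + C := h n hn
      _ ≤ (1 + 2 * (1 - ε) / ((n : ℝ) + 1)) * (K * A) + C := by
        have : 0 ≤ 2 * (1 - ε) / ((n : ℝ) + 1) := div_nonneg (by linarith) (by positivity)
        gcongr
      _ ≤ (1 + 2 * (1 - ε) / n) * (K * A) + K * (ε * (A / n)) := by
        gcongr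
      _ = K * (A * (1 + (2 - ε) / n)) := by ring
      _ ≤ K * ((n : ℝ) + 1) ^ (2 - ε) := by gcongr

/-- Nonnegative random variables with summable means tend to zero almost surely. -/
theorem ae_tendsto_zero_of_integral_le {Ω : Type*} [MeasurableSpace Ω] {P : Measure Ω}
    {q : ℕ → Ω → ℝ} (hq0 : ∀ j ω, 0 ≤ q j ω) (hq : ∀ j, Integrable (q j) P) {b : ℕ → ℝ}
    (hb : Summable b) (hle : ∀ j, ∫ ω, q j ω ∂P ≤ b j) :
    ∀ᵐ ω ∂P, Tendsto (fun j => q j ω) atTop (𝓝 0) := by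
  have hb0 : ∀ j, 0 ≤ b j := fun j => (integral_nonneg (hq0 j)).trans (hle j)
  have hmeas : ∀ j, AEMeasurable (fun ω => ENNReal.ofReal (q j ω)) P := fun j =>
    (hq j).aestronglyMeasurable.aemeasurable.ennreal_ofReal
  have hfin : ∫⁻ ω, ∑' j, ENNReal.ofReal (q j ω) ∂P ≠ ⊤ := by
    rw [lintegral_tsum hmeas]
    refine ne_top_of_le_ne_top hb.tsum_ofReal_ne_top (ENNReal.tsum_le_tsum fun j => ?_)
    rw [← ofReal_integral_eq_lintegral_ofReal (hq j) (Eventually.of_forall (hq0 j))]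
    exact ENNReal.ofReal_le_ofReal (hle j)
  filter_upwards [ae_lt_top' (AEMeasurable.tsum hmeas) hfin] with ω hω
  have h1 := ENNReal.tendsto_atTop_zero_of_tsum_ne_top hω.ne
  have h2 := (ENNReal.tendsto_toReal ENNReal.zero_ne_top).comp h1
  simpa [Function.comp_def, ENNReal.toReal_ofReal, hq0] using h2

/-- A sequence with downward jumps of size at most one has a linear rate of growth as soon as it has
one along the `a`-th powers. -/
theorem tendsto_div_of_tendsto_div_pow {z : ℕ → ℝ} (hz : ∀ n, z n ≤ z (n + 1) + 1) {a : ℕ}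
    (ha : a ≠ 0) {l : ℝ}
    (h : Tendsto (fun j : ℕ => z (j ^ a) / ((j ^ a : ℕ) : ℝ)) atTop (𝓝 l)) :
    Tendsto (fun n : ℕ => z n / (n : ℝ)) atTop (𝓝 l) := by
  have hmono : Monotone fun n : ℕ => z n + n := monotone_nat_of_le_succ fun n => by
    push_cast; linarith [hz n]
  have key := tendsto_div_of_monotone_of_exists_subseq_tendsto_div (fun n : ℕ => z n + n) (l + 1)
    hmono fun b hb => by
      refine ⟨fun j => j ^ a, ?_, tendsto_pow_atTop ha, ?_⟩
      · have h1 : Tendsto (fun j : ℕ => (1 + 1 / (j : ℝ)) ^ a) atTop (𝓝 1) := by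
          have := ((tendsto_const_nhds (x := (1 : ℝ))).add
            tendsto_one_div_atTop_nhds_zero_nat).pow a
          simpa using this
        filter_upwards [h1.eventually_le_const hb, eventually_gt_atTop 0] with j hj hj0
        have hj0' : (0 : ℝ) < j := by exact_mod_cast hj0
        push_cast
        have h2 : (j : ℝ) + 1 = (1 + 1 / (j : ℝ)) * j := by field_simp
        rw [h2, mul_pow]
        gcongr
      · refine (h.add_const 1).congr' ?_
        filter_upwards [eventually_gt_atTop 0] with j hj
        have : ((j ^ a : ℕ) : ℝ) ≠ 0 := by exact_mod_cast (pow_pos hj a).ne'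
        field_simp
  have h3 := key.sub_const 1
  rw [add_sub_cancel_right] at h3
  refine h3.congr' ?_
  filter_upwards [eventually_gt_atTop 0] with n hn
  have : (n : ℝ) ≠ 0 := by exact_mod_cast hn.ne'
  field_simp
  ring

end Analysis

namespace MTree

section Deviation

variable {m : ℕ}

theorem numStage_zero {α : Type} [LinearOrder α] {T : MTree m α} (hT : T.IsSearch) :
    T.numStage 0 = 0 := by
  induction T with
  | nil => rfl
  | node keys c ih =>
    obtain ⟨h1, h2, h3, h4, h5⟩ := hT
    simp only [numStage, ih _ (h5 _), Finset.sum_const_zero, add_zero]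
    rw [if_neg (by omega)]

/-- The deviation of the number of nodes of stage `s`, after `n` insertions, from its limit
proportion of the number `n + 1` of gaps. -/
noncomputable def deviation (m : ℕ) (x : ℕ → ℝ) (n s : ℕ) : ℝ :=
  ((grow m x n).numStage s : ℝ) - ((n : ℝ) + 1) * stageDensity m s

theorem patternInvariant_deviation (hm : 2 ≤ m) (n : ℕ) :
    PatternInvariant n fun x => deviation m x n := by
  intro x y h
  funext s
  simp only [deviation, numStage_grow_congr hm (orderPattern_eq_iff.1 h) s]

theorem deviation_succ (hm : 2 ≤ m) (x : ℕ → ℝ) {n : ℕ} (hn : 1 ≤ n) (s : ℕ) :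
    deviation m x (n + 1) s = deviation m x n s
      + (hitChange m ((grow m x n).hitStage (x n)) s - stageDensity m s) := by
  obtain ⟨k, rfl⟩ : ∃ k, n = k + 1 := ⟨n - 1, by omega⟩
  have h := numStage_insert hm (x (k + 1)) (isSearch_grow hm x (k + 1)) (isNil_grow_succ x k) s
  have h' : ((grow m x (k + 1 + 1)).numStage s : ℝ)
      + (if (grow m x (k + 1)).hitStage (x (k + 1)) = s then 1 else 0)
      = (grow m x (k + 1)).numStage s
        + (if (grow m x (k + 1)).hitStage (x (k + 1)) + 1 = s then 1 else 0)
        + (if m - 1 ≤ (grow m x (k + 1)).hitStage (x (k + 1)) ∧ s = 1 then 1 else 0) := by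
    rw [grow]; exact_mod_cast h
  have hb : (if m - 1 ≤ (grow m x (k + 1)).hitStage (x (k + 1)) ∧ s = 1 then (1 : ℝ) else 0)
      = if s = 1 then birth m ((grow m x (k + 1)).hitStage (x (k + 1))) else 0 := by
    unfold birth
    split_ifs <;> first | rfl | omega
  rw [hb] at h'
  unfold deviation hitChange
  push_cast
  linear_combination h'

theorem hitStage_eq_of_inGap (hm : 2 ≤ m) {x : ℕ → ℝ} (hx : Function.Injective x) {n : ℕ}
    {o : Option (Fin n)} (ho : InGap n o x) :
    (grow m x n).hitStage (x n) = (grow m x n).hitStage (gapPoint n x o) := by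
  refine hitStage_congr fun z hz => ?_
  rw [keyMultiset_grow hm] at hz
  obtain ⟨i, hi, rfl⟩ := Multiset.mem_map.1 hz
  rw [Multiset.mem_range] at hi
  have h1 : x i ≠ x n := fun h => hi.ne (hx h)
  rw [h1.le_iff_lt, ho ⟨i, hi⟩]

/-- Among the `n + 1` gaps, those at nodes of stage `h` are `stageWeight m h` times as many as
these nodes. -/
theorem sum_gapPoint (hm : 2 ≤ m) {x : ℕ → ℝ} (hx : Function.Injective x) {n : ℕ} (hn : 1 ≤ n)
    (f : ℕ → ℝ) :
    ∑ o : Option (Fin n), f ((grow m x n).hitStage (gapPoint n x o))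
      = ∑ h ∈ Finset.Icc 1 (2 * m - 2),
        (stageWeight m h : ℝ) * (deviation m x n h + ((n : ℝ) + 1) * stageDensity m h) * f h := by
  obtain ⟨k, rfl⟩ : ∃ k, n = k + 1 := ⟨n - 1, by omega⟩
  have hS := isSearch_grow hm x (k + 1)
  have h := sum_hitStage hm f hS (isNil_grow_succ x k) (b := gapPoint (k + 1) x none) (by
      intro y hy
      rw [keyMultiset_grow hm] at hy
      obtain ⟨i, hi, rfl⟩ := Multiset.mem_map.1 hy
      exact gapPoint_none_lt x (Multiset.mem_range.1 hi)) (by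
      rw [keyMultiset_grow hm]
      exact (Multiset.nodup_range _).map hx)
  have hL : ∑ o : Option (Fin (k + 1)), f ((grow m x (k + 1)).hitStage (gapPoint (k + 1) x o))
      = ((gapPoint (k + 1) x none ::ₘ (grow m x (k + 1)).keyMultiset).map
        fun y => f ((grow m x (k + 1)).hitStage y)).sum := by
    rw [Fintype.sum_option, Multiset.map_cons, Multiset.sum_cons, keyMultiset_grow hm,
      Multiset.map_map]
    congr 1
    simp only [gapPoint]
    rw [← Finset.sum_range fun i => f ((grow m x (k + 1)).hitStage (x i))]
    rfl
  rw [hL, h]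
  simp only [deviation, sub_add_cancel]
  symm
  refine Finset.sum_subset (fun s hs => ?_) fun s hs hs' => ?_
  · rw [Finset.mem_Icc] at hs
    exact Finset.mem_range.2 (by omega)
  · rw [Finset.mem_range] at hs
    rw [Finset.mem_Icc] at hs'
    rcases Nat.eq_zero_or_pos s with rfl | h0
    · rw [numStage_zero hS]; simp
    · have : s = 2 * m - 2 + 1 := by omega
      rw [this, stageWeight_last hm]; simp

theorem sum_weight_mul_deviation (hm : 2 ≤ m) {x : ℕ → ℝ} (hx : Function.Injective x) {n : ℕ}
    (hn : 1 ≤ n) :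
    ∑ s ∈ Finset.Icc 1 (2 * m - 2), (stageWeight m s : ℝ) * deviation m x n s = 0 := by
  have h := sum_gapPoint hm hx hn fun _ => 1
  simp only [mul_one, Finset.sum_const, Finset.card_univ, Fintype.card_option, Fintype.card_fin,
    nsmul_eq_mul, mul_add, Finset.sum_add_distrib] at h
  have h2 : ∑ s ∈ Finset.Icc 1 (2 * m - 2),
      (stageWeight m s : ℝ) * (((n : ℝ) + 1) * stageDensity m s) = (n : ℝ) + 1 := by
    calc _ = ((n : ℝ) + 1) * ∑ s ∈ Finset.Icc 1 (2 * m - 2),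
          (stageWeight m s : ℝ) * stageDensity m s := by
          rw [Finset.mul_sum]
          exact Finset.sum_congr rfl fun s _ => by ring
      _ = (n : ℝ) + 1 := by rw [sum_weight_mul_density hm, mul_one]
  push_cast at h
  linarith

end Deviation

section Convergence

variable {Ω : Type*} [MeasurableSpace Ω] {P : Measure Ω} [IsProbabilityMeasure P]
  {X : ℕ → Ω → ℝ} {m : ℕ}

theorem patternInvariant_energy (hm : 2 ≤ m) (n : ℕ) :
    PatternInvariant n fun x => energy m (deviation m x n) := fun x y h => by
  simp only [patternInvariant_deviation hm n x y h]

/-- The mean energy of the deviation is of order less than `n ^ 2`. -/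
theorem exists_integral_energy_le (hX : IsRandomPermutationModel P X) (hm : 2 ≤ m) :
    ∃ ε K : ℝ, 0 < ε ∧ ε < 1 ∧ 0 ≤ K ∧ ∀ n : ℕ, 1 ≤ n →
      ∫ ω, energy m (deviation m (fun i => X i ω) n) ∂P ≤ K * (n : ℝ) ^ (2 - ε) := by
  obtain ⟨ε, C, hε, hε1, hC, hstep⟩ := exists_energy_step hm
  obtain ⟨K, hK, h⟩ := exists_le_rpow_of_recursion hε hε1 hC
    (e := fun n => ∫ ω, energy m (deviation m (fun i => X i ω) n) ∂P) fun n hn => by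
      set K : Option (Fin n) → (ℕ → ℝ) → ℝ := fun o x => energy m fun s => deviation m x n s
        + (hitChange m ((grow m x n).hitStage (gapPoint n x o)) s - stageDensity m s) with hKdef
      have hKinv : ∀ o, PatternInvariant n (K o) := by
        intro o x y hxy
        simp only [hKdef, patternInvariant_deviation hm n x y hxy,
          hitStage_grow_congr hm (orderPattern_eq_iff.1 hxy)
            (fun i hi => le_gapPoint_iff hxy o hi) (fun i hi => gapPoint_le_iff hxy o hi)]
      have havg := hX.integral_eq_average_gaps (patternInvariant_energy hm (n + 1)) hKinv
        fun x hx o ho => by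
          simp only [hKdef]
          congr 1
          funext s
          rw [deviation_succ hm x hn, hitStage_eq_of_inGap hm hx ho]
      have hint := hX.integrable_of_patternInvariant (patternInvariant_energy hm n)
      have hn1 : (0 : ℝ) < (n : ℝ) + 1 := by positivity
      have hle : ∫ ω, ∑ o, K o (fun i => X i ω) ∂P
          ≤ ∫ ω, (((n : ℝ) + 1 + 2 * (1 - ε)) * energy m (deviation m (fun i => X i ω) n)
            + C * ((n : ℝ) + 1)) ∂P := by
        refine integral_mono_ae (integrable_finsetSum _ fun o _ =>
          hX.integrable_of_patternInvariant (hKinv o)) ((hint.const_mul _).add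
          (integrable_const _)) ?_
        filter_upwards [hX.ae_injective] with ω hω
        have h1 := sum_gapPoint hm hω hn fun h => energy m fun s =>
          deviation m (fun i => X i ω) n s + (hitChange m h s - stageDensity m s)
        simp only [hKdef]
        rw [h1]
        refine hstep _ _ (fun s => ?_) (sum_weight_mul_deviation hm hω hn)
        simp only [deviation, sub_add_cancel]
        exact Nat.cast_nonneg _
      rw [integral_add (hint.const_mul _) (integrable_const _), integral_const_mul,
        integral_const, probReal_univ, one_smul] at hle
      rw [havg]
      calc _ ≤ ((n : ℝ) + 1)⁻¹ * (((n : ℝ) + 1 + 2 * (1 - ε)) *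
            ∫ ω, energy m (deviation m (fun i => X i ω) n) ∂P + C * ((n : ℝ) + 1)) := by gcongr
        _ = _ := by field_simp
  exact ⟨ε, K, hε, hε1, hK, h⟩

/-- Almost surely, the number of nodes of stage `s` divided by the number of keys converges. The mean
energy, normalized by `n ^ 2`, is summable along a sequence of powers, which gives the convergence
along this sequence; the profile changes slowly between its terms. -/
theorem ae_tendsto_numStage (hX : IsRandomPermutationModel P X) (hm : 2 ≤ m) :
    ∀ᵐ ω ∂P, ∀ s ∈ Finset.Icc 1 (2 * m - 2), Tendsto
      (fun n : ℕ => ((grow m (fun i => X i ω) n).numStage s : ℝ) / (n : ℝ)) atTop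
      (𝓝 (stageDensity m s)) := by
  obtain ⟨ε, K, hε, hε1, hK, hE⟩ := exists_integral_energy_le hX hm
  obtain ⟨a, ha⟩ := exists_nat_ge (2 / ε)
  have haε : 2 ≤ (a : ℝ) * ε := (div_le_iff₀ hε).1 ha
  have ha0 : a ≠ 0 := by rintro rfl; norm_num at haε
  -- The subsequence is indexed by the powers `(j + 1) ^ a`, which avoids the value `0`.
  have hae : ∀ᵐ ω ∂P, Tendsto (fun j : ℕ => energy m (deviation m (fun i => X i ω) ((j + 1) ^ a))
      / (((j + 1) ^ a : ℕ) : ℝ) ^ 2) atTop (𝓝 0) := by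
    refine ae_tendsto_zero_of_integral_le (b := fun j : ℕ => K * (1 / ((j + 1 : ℕ) : ℝ) ^ 2))
      (fun j ω => div_nonneg (energy_nonneg hm _) (sq_nonneg _))
      (fun j => (hX.integrable_of_patternInvariant (patternInvariant_energy hm _)).div_const _)
      (((summable_nat_add_iff 1).2 (Real.summable_one_div_nat_pow.2 one_lt_two)).mul_left K)
      fun j => ?_
    have hj1 : (1 : ℝ) ≤ ((j + 1 : ℕ) : ℝ) := by exact_mod_cast Nat.succ_pos j
    have hj0 : (0 : ℝ) < ((j + 1 : ℕ) : ℝ) := by positivity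
    have h1 := hE ((j + 1) ^ a) (Nat.one_le_pow _ _ (Nat.succ_pos j))
    rw [integral_div, div_le_iff₀ (by positivity)]
    refine h1.trans ?_
    rw [mul_assoc]
    refine mul_le_mul_of_nonneg_left ?_ hK
    rw [Nat.cast_pow]
    set t := ((j + 1 : ℕ) : ℝ) with ht
    calc (t ^ a) ^ (2 - ε) = t ^ ((a : ℝ) * (2 - ε)) := by
          rw [← Real.rpow_natCast, ← Real.rpow_mul hj0.le]
      _ ≤ t ^ ((a : ℝ) * 2 - 2) := Real.rpow_le_rpow_of_exponent_le hj1 (by linarith)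
      _ = 1 / t ^ 2 * (t ^ a) ^ 2 := by
          rw [Real.rpow_sub hj0, Real.rpow_mul hj0.le, Real.rpow_natCast, Real.rpow_two,
            Real.rpow_two]
          ring
  filter_upwards [hae] with ω hω s hs
  set x : ℕ → ℝ := fun i => X i ω with hx
  refine tendsto_div_of_tendsto_div_pow (z := fun n => ((grow m x n).numStage s : ℝ))
    (fun n => ?_) ha0 ((tendsto_add_atTop_iff_nat 1).1 ?_)
  · cases n with
    | zero => simp only [grow, numStage, Nat.cast_zero]; positivity
    | succ k =>
      have h := numStage_insert hm (x (k + 1)) (isSearch_grow hm x (k + 1)) (isNil_grow_succ x k) s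
      have h' : (grow m x (k + 1)).numStage s ≤ (grow m x (k + 1 + 1)).numStage s + 1 := by
        change _ ≤ (insert (x (k + 1)) (grow m x (k + 1))).numStage s + 1
        split_ifs at h <;> omega
      exact_mod_cast h'
  · have hsq : Tendsto (fun j : ℕ => (deviation m x ((j + 1) ^ a) s / (((j + 1) ^ a : ℕ) : ℝ)) ^ 2)
        atTop (𝓝 0) := by
      have h0 := hω.const_mul (stageDensity m s / stageWeight m s)
      rw [mul_zero] at h0
      refine squeeze_zero (fun _ => sq_nonneg _) (fun j => ?_) h0
      rw [div_pow, ← mul_div_assoc]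
      exact div_le_div_of_nonneg_right (sq_le_mul_energy hm _ hs) (sq_nonneg _)
    have hdev : Tendsto (fun j : ℕ => deviation m x ((j + 1) ^ a) s / (((j + 1) ^ a : ℕ) : ℝ))
        atTop (𝓝 0) := by
      have h1 := hsq.sqrt
      simp only [Real.sqrt_sq_eq_abs, Real.sqrt_zero] at h1
      exact (tendsto_zero_iff_abs_tendsto_zero _).2 h1
    have hpow : Tendsto (fun j : ℕ => (j + 1) ^ a) atTop atTop :=
      (tendsto_pow_atTop ha0).comp (tendsto_add_atTop_nat 1)
    have hinv : Tendsto (fun j : ℕ => 1 / (((j + 1) ^ a : ℕ) : ℝ)) atTop (𝓝 0) :=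
      tendsto_one_div_atTop_nhds_zero_nat.comp hpow
    have hlim := hdev.add ((hinv.const_add 1).mul_const (stageDensity m s))
    rw [zero_add, add_zero, one_mul] at hlim
    refine hlim.congr fun j => ?_
    have : (((j + 1) ^ a : ℕ) : ℝ) ≠ 0 := by positivity
    simp only [deviation]
    field_simp
    ring

end Convergence

theorem sum_stageDensity_leaf {m : ℕ} (hm : 2 ≤ m) :
    ∑ s ∈ Finset.Icc 1 (m - 1), stageDensity m s
      = ((m : ℝ) - 1) / (2 * ((m : ℝ) + 1) * ((harmonic m : ℝ) - 1)) := by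
  have h0 := (sub_pos.2 (one_lt_harmonic hm)).ne'
  have htel : ∀ k : ℕ, ∑ s ∈ Finset.Icc 1 k, 1 / (((s : ℝ) + 1) * (s + 2))
      = 1 / 2 - 1 / ((k : ℝ) + 2) := by
    intro k
    induction k with
    | zero => norm_num
    | succ k ih =>
      rw [Finset.sum_Icc_succ_top (by omega), ih]
      have h1 : (k : ℝ) + 2 ≠ 0 := by positivity
      have h2 : (k : ℝ) + 3 ≠ 0 := by positivity
      have h3 : (k : ℝ) + 1 + 1 ≠ 0 := by positivity
      have h4 : (k : ℝ) + 1 + 2 ≠ 0 := by positivity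
      push_cast
      field_simp
      ring
  have h1 : ∑ s ∈ Finset.Icc 1 (m - 1), stageDensity m s
      = (∑ s ∈ Finset.Icc 1 (m - 1), 1 / (((s : ℝ) + 1) * (s + 2))) / ((harmonic m : ℝ) - 1) := by
    rw [Finset.sum_div]
    refine Finset.sum_congr rfl fun s hs => ?_
    rw [Finset.mem_Icc] at hs
    rw [stageDensity, if_pos (by omega)]
  rw [h1, htel, Nat.cast_sub (by omega)]
  have h2 : (m : ℝ) + 1 ≠ 0 := by positivity
  have h3 : (m : ℝ) - 1 + 2 ≠ 0 := by
    have : (m : ℝ) - 1 + 2 = m + 1 := by ring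
    rwa [this]
  push_cast
  field_simp
  ring

/-- The number of nodes of maximal outdegree, expressed by the numbers of the other nodes through
the relation between the numbers of nodes and edges. -/
theorem sub_one_mul_numOutdegree_self {m : ℕ} {α : Type} {T : MTree m α} (hne : T.isNil = false) :
    ((m : ℝ) - 1) * T.numOutdegree m
      = ∑ k ∈ Finset.range m, (1 - (k : ℝ)) * T.numOutdegree k - 1 := by
  have h := sum_mul_numOutdegree T
  rw [hne, Finset.sum_range_succ, Finset.sum_range_succ] at h
  have h' : ∑ k ∈ Finset.range m, (k : ℝ) * T.numOutdegree k + m * T.numOutdegree m + 1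
      = ∑ k ∈ Finset.range m, (T.numOutdegree k : ℝ) + T.numOutdegree m := by exact_mod_cast h
  simp only [sub_mul, one_mul, Finset.sum_sub_distrib]
  linear_combination h'

theorem sum_range_one_sub_mul {m : ℕ} (hm : 2 ≤ m) {d : ℕ → ℝ} {β : ℝ}
    (hd : ∀ k, 1 ≤ k → k < m → d k = β) :
    ∑ k ∈ Finset.range m, (1 - (k : ℝ)) * d k
      = d 0 - ((m : ℝ) - 1) * ((m : ℝ) - 2) / 2 * β := by
  induction m, hm using Nat.le_induction with
  | base => simp [Finset.sum_range_succ]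
  | succ n hn ih =>
    rw [Finset.sum_range_succ, ih fun k hk hkn => hd k hk (by omega), hd n (by omega) (by omega)]
    push_cast
    ring

end MTree

theorem mainTheorem2 {Ω : Type*} [MeasurableSpace Ω] (P : Measure Ω) [IsProbabilityMeasure P]
    (X : ℕ → Ω → ℝ) (hX : IsRandomPermutationModel P X) (m : ℕ) (hm : 2 ≤ m) :
    (∀ᵐ ω ∂P, Tendsto
      (fun n : ℕ => ((MTree.grow m (fun i => X i ω) n).numOutdegree 0 : ℝ) / (n : ℝ)) atTop
      (𝓝 (((m : ℝ) - 1) / (2 * ((m : ℝ) + 1) * ((harmonic m : ℝ) - 1))))) ∧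
    ∀ k : ℕ, 1 ≤ k → k ≤ m →
      ∀ᵐ ω ∂P, Tendsto
        (fun n : ℕ => ((MTree.grow m (fun i => X i ω) n).numOutdegree k : ℝ) / (n : ℝ)) atTop
        (𝓝 (1 / ((m : ℝ) * ((m : ℝ) + 1) * ((harmonic m : ℝ) - 1)))) := by
  have hmain := MTree.ae_tendsto_numStage hX hm
  set c := (harmonic m : ℝ) - 1 with hc
  have hleaf : ∀ᵐ ω ∂P, Tendsto
      (fun n : ℕ => ((MTree.grow m (fun i => X i ω) n).numOutdegree 0 : ℝ) / (n : ℝ)) atTop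
      (𝓝 (((m : ℝ) - 1) / (2 * ((m : ℝ) + 1) * c))) := by
    filter_upwards [hmain] with ω hω
    rw [hc, ← MTree.sum_stageDensity_leaf hm]
    refine (tendsto_finsetSum _ fun s hs => hω s ?_).congr fun n => ?_
    · rw [Finset.mem_Icc] at hs ⊢; omega
    · rw [MTree.numOutdegree_zero_eq_sum (MTree.isSearch_grow hm _ n), Nat.cast_sum,
        Finset.sum_div]
  have hinner : ∀ᵐ ω ∂P, ∀ k : ℕ, 1 ≤ k → k < m → Tendsto
        (fun n : ℕ => ((MTree.grow m (fun i => X i ω) n).numOutdegree k : ℝ) / (n : ℝ)) atTop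
        (𝓝 (1 / ((m : ℝ) * ((m : ℝ) + 1) * c))) := by
    filter_upwards [hmain] with ω hω k hk hkm
    have h1 := hω (m - 1 + k) (Finset.mem_Icc.2 ⟨by omega, by omega⟩)
    rw [MTree.stageDensity, if_neg (by omega), div_div] at h1
    refine h1.congr fun n => ?_
    rw [MTree.numOutdegree_eq_numStage hk (MTree.isSearch_grow hm _ n)]
  refine ⟨hleaf, fun k hk hkm => ?_⟩
  rcases hkm.lt_or_eq with hlt | rfl
  · filter_upwards [hinner] with ω hω using hω k hk hlt
  filter_upwards [hleaf, hinner] with ω h0 h1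
  have hk1 : (k : ℝ) - 1 ≠ 0 := by
    have : (2 : ℝ) ≤ k := by exact_mod_cast hm
    linarith
  have hc0 : c ≠ 0 := (sub_pos.2 (MTree.one_lt_harmonic hm)).ne'
  set d : ℕ → ℝ := fun j => if j = 0 then ((k : ℝ) - 1) / (2 * ((k : ℝ) + 1) * c)
    else 1 / ((k : ℝ) * ((k : ℝ) + 1) * c) with hd
  have hall : ∀ j ∈ Finset.range k, Tendsto (fun n : ℕ => (1 - (j : ℝ)) *
      (((MTree.grow k (fun i => X i ω) n).numOutdegree j : ℝ) / (n : ℝ))) atTop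
      (𝓝 ((1 - (j : ℝ)) * d j)) := by
    intro j hj
    refine Tendsto.const_mul _ ?_
    rcases Nat.eq_zero_or_pos j with rfl | hj0
    · simpa only [hd, if_pos] using h0
    · simpa only [hd, if_neg hj0.ne'] using h1 j hj0 (Finset.mem_range.1 hj)
  have hsum := ((tendsto_finsetSum _ hall).sub tendsto_one_div_atTop_nhds_zero_nat).const_mul
    ((k : ℝ) - 1)⁻¹
  have hlim : ((k : ℝ) - 1)⁻¹ * (∑ j ∈ Finset.range k, (1 - (j : ℝ)) * d j - 0)
      = 1 / ((k : ℝ) * ((k : ℝ) + 1) * c) := by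
    have hk2 : (k : ℝ) ≠ 0 := by positivity
    have hk3 : (k : ℝ) + 1 ≠ 0 := by positivity
    rw [MTree.sum_range_one_sub_mul hm (β := 1 / ((k : ℝ) * ((k : ℝ) + 1) * c))
      fun j hj _ => by simp only [hd, if_neg (show j ≠ 0 by omega)]]
    simp only [hd, if_pos]
    field_simp
    ring
  rw [hlim] at hsum
  refine hsum.congr' ?_
  filter_upwards [eventually_gt_atTop 0] with n hn
  obtain ⟨p, rfl⟩ : ∃ p, n = p + 1 := ⟨n - 1, by omega⟩
  have h2 := MTree.sub_one_mul_numOutdegree_self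
    (MTree.isNil_grow_succ (m := k) (fun i => X i ω) p)
  rw [inv_mul_eq_iff_eq_mul₀ hk1, ← mul_div_assoc, h2, sub_div, Finset.sum_div]
  congr 1
  exact Finset.sum_congr rfl fun j _ => by ring
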